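/- Let $\alpha\in(\tfrac12,1]$. For real $\beta$ and $z\in\mathbb{C}$ let $E_{\alpha,\beta}(z)=\sum_{r=0}^{\infty}\frac{z^r}{\Gamma(\alpha r+\beta)}$ be the two-parameter Mittag-Leffler function, with $1/\Gamma:=0$ at the poles of $\Gamma$. For constants $c,\gamma,k>0$ and $\ell\in\mathbb{N}_0$ put $$\lambda_\ell=\ell(\ell+1),\qquad \omega=\frac{c}{2\gamma k},\qquad \varkappa=\tfrac12\bigl(\sqrt{1+4\omega^2}-1\bigr),$$ $$M_\ell=\begin{cases}\sqrt{1-\lambda_\ell\omega^{-2}},&\ell\le\varkappa,\\ \mathrm{i}\sqrt{\lambda_\ell\omega^{-2}-1},&\ell>\varkappa,\end{cases}\qquad z_\ell^{\pm}=\frac{c^2}{2\gamma}\,(1\pm M_\ell)$$ (so that $z_\ell^{+}=z_\ell^{-}=\frac{c^2}{2\gamma}$ if $\ell=\varkappa$). Then there are numbers $K_\ell=K_\ell(\alpha,c,\gamma,k)$, with $K_\ell>0$ for every $\ell>\varkappa$, such that for every $\beta\in\mathbb{R}$ there are positive constants $C_1,C_2,C_3$, depending only on $\alpha$ and $\beta$,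 for which the following holds for all $c,\gamma,k>0$, all $\ell\in\mathbb{N}_0$, all $t\ge 0$ and both choices of the sign $\pm$: $$\bigl|E_{\alpha,\beta}(-z_\ell^{\pm}t^{\alpha})\bigr|\le\begin{cases}C_1\bigl(1+kct^{\alpha}\sqrt{\lambda_\ell}\bigr)^{\frac{1-\beta}{\alpha}}\,e^{-K_\ell\,t\,(k^2c^2\lambda_\ell)^{1/(2\alpha)}}+\dfrac{C_2}{1+kct^{\alpha}\sqrt{\lambda_\ell}},&\ell>\varkappa,\\[2ex]\dfrac{C_3}{1+|z_\ell^{\pm}|\,t^{\alpha}},&\ell\le\varkappa.\end{cases}$$ -/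

import Mathlib

noncomputable section

namespace HyperbolicDiffusion

/-- The two-parameter Mittag-Leffler function `E_{a,b}(z) = ∑ r, z ^ r / Γ(a r + b)`, for real
parameters `a > 0` and `b`.  When `a r + b` is a pole of `Γ`, the coefficient `1 / Γ(a r + b)` is
`0`, as usual (Mathlib's `Γ` takes the value `0` at its poles, and `w / 0 = 0`). -/
def mittagLeffler (a b : ℝ) (z : ℂ) : ℂ :=
  ∑' r : ℕ, z ^ r / Complex.Gamma ((a : ℂ) * (r : ℂ) + (b : ℂ))

/-- The eigenvalues `λ_ℓ = ℓ (ℓ + 1)` of the negative Laplace-Beltrami operator on the sphere. -/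
def lam (l : ℕ) : ℝ := (l : ℝ) * ((l : ℝ) + 1)

/-- `ω = c / (2 γ k)`. -/
def omega (c γ k : ℝ) : ℝ := c / (2 * γ * k)

/-- The critical degree `ϰ = (√(1 + 4 ω²) - 1) / 2`. -/
def kappa (c γ k : ℝ) : ℝ := (1 / 2) * (Real.sqrt (1 + 4 * omega c γ k ^ 2) - 1)

open scoped Classical in
/-- `M_ℓ = √(1 - λ_ℓ ω⁻²)` for `ℓ ≤ ϰ` and `M_ℓ = i √(λ_ℓ ω⁻² - 1)` for `ℓ > ϰ`. -/
def bigM (c γ k : ℝ) (l : ℕ) : ℂ :=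
  if (l : ℝ) ≤ kappa c γ k then
    ((Real.sqrt (1 - lam l / omega c γ k ^ 2) : ℝ) : ℂ)
  else
    Complex.I * ((Real.sqrt (lam l / omega c γ k ^ 2 - 1) : ℝ) : ℂ)

/-- `z_ℓ⁺ = (c² / (2 γ)) (1 + M_ℓ)`. -/
def zPlus (c γ k : ℝ) (l : ℕ) : ℂ := ((c ^ 2 / (2 * γ) : ℝ) : ℂ) * (1 + bigM c γ k l)

/-- `z_ℓ⁻ = (c² / (2 γ)) (1 - M_ℓ)`. -/
def zMinus (c γ k : ℝ) (l : ℕ) : ℂ := ((c ^ 2 / (2 * γ) : ℝ) : ℂ) * (1 - bigM c γ k l)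

end HyperbolicDiffusion

end

open Filter Topology MeasureTheory

namespace HyperbolicDiffusion

/-! Every argument `-z t ^ α` lies in the closed left half plane, and on the negative real axis when
`ℓ ≤ ϰ`. So it suffices to bound `E_{α,β}` there by constants depending only on `α` and `β`; this is
`exists_norm_mittagLeffler_le`.

For `α < 1` the function decays like `1 / ‖w‖` on the whole closed left half plane, so the
exponential term is only a nonnegative extra. Hankel's formula (`hankelRay_sub_hankelRay`) writes
each `1 / Γ(α r + β)` as an integral of `e ^ s * s ^ (-(α r + β))` over two rays from `1`. Summing
the series turns the integrand into `e ^ s * s ^ (α - β) / (s ^ α - w)`. The rays can be tilted so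
that `e ^ s` decays while `s ^ α` stays in a closed sector inside the right half plane; there `‖s ^
α - w‖` is at least a fixed multiple of `‖w‖`.

For `α = 1` no such tilt exists. Instead `E_{1,β}` solves a first-order linear ODE, and integrating
it along segments that avoid `0` gives the bound `‖w‖ ^ (1 - β) * e ^ (Re w) + 1 / ‖w‖`, up to a
constant. On the negative axis the exponential absorbs the power.

Finally, for `ℓ > ϰ` both `z_ℓ^±` have modulus `k c √λ_ℓ` and real part `k c ω`, so `K_ℓ = ω /
√λ_ℓ`, the cosine of their argument, works. -/

/-! ### Convergence and regularity of the Mittag-Leffler series. -/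

lemma rpow_mul_exp_le_Gamma {R x : ℝ} (hR : 0 < R) (hx : 1 ≤ x) :
    R ^ (x - 1) * Real.exp (-(R + 1)) ≤ Real.Gamma x := by
  rw [Real.Gamma_eq_integral (by linarith)]
  have hint := Real.GammaIntegral_convergent (s := x) (by linarith)
  -- Only the part of Euler's integral over `(R, R + 1]` is kept. As `R` is arbitrary, `1 / Γ`
  -- decays faster than any geometric sequence.
  have hsub : Set.Ioc R (R + 1) ⊆ Set.Ioi 0 := fun y hy => hR.trans hy.1
  calc R ^ (x - 1) * Real.exp (-(R + 1))
      = ∫ _ in Set.Ioc R (R + 1), R ^ (x - 1) * Real.exp (-(R + 1)) := by simp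
    _ ≤ ∫ y in Set.Ioc R (R + 1), Real.exp (-y) * y ^ (x - 1) := by
        refine setIntegral_mono_on (integrableOn_const (by simp)) (hint.mono_set hsub) measurableSet_Ioc ?_
        intro y hy
        have h1 : R ^ (x - 1) ≤ y ^ (x - 1) :=
          Real.rpow_le_rpow hR.le hy.1.le (by linarith)
        have h2 : Real.exp (-(R + 1)) ≤ Real.exp (-y) :=
          Real.exp_le_exp.2 (neg_le_neg hy.2)
        have : 0 < R ^ (x - 1) := by positivity
        rw [mul_comm]
        gcongr
    _ ≤ ∫ y in Set.Ioi 0, Real.exp (-y) * y ^ (x - 1) := by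
        refine setIntegral_mono_set hint ?_ hsub.eventuallyLE
        filter_upwards [ae_restrict_mem measurableSet_Ioi] with y hy
        have : (0 : ℝ) < y := hy
        positivity

/-- The coefficients of the Mittag-Leffler series. -/
noncomputable def mlCoeff (a b : ℝ) (r : ℕ) : ℂ := (Complex.Gamma ((a * r + b : ℝ) : ℂ))⁻¹

lemma mittagLeffler_eq_tsum (a b : ℝ) (z : ℂ) :
    mittagLeffler a b z = ∑' r : ℕ, z ^ r * mlCoeff a b r := by
  simp [mittagLeffler, mlCoeff, div_eq_mul_inv]

lemma summable_pow_mul_norm_mlCoeff {a : ℝ} (ha : 0 < a) (b : ℝ) {ρ : ℝ} (hρ : 0 ≤ ρ) :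
    Summable fun r : ℕ => ρ ^ r * ‖mlCoeff a b r‖ := by
  -- With `R ^ a = 2 ρ + 1` the terms are dominated by a geometric series of ratio `ρ / (2 ρ + 1) ≤
  -- 1 / 2`.
  set R : ℝ := (2 * ρ + 1) ^ (1 / a) with hRdef
  have hR : 0 < R := by positivity
  have hRa : R ^ a = 2 * ρ + 1 := by
    rw [hRdef, ← Real.rpow_mul (by positivity), one_div_mul_cancel ha.ne', Real.rpow_one]
  have hsum : Summable fun r : ℕ => Real.exp (R + 1) * R ^ (1 - b) * (1 / 2 : ℝ) ^ r :=
    (summable_geometric_of_lt_one (by norm_num) (by norm_num)).mul_left _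
  refine Summable.of_norm_bounded_eventually_nat hsum ?_
  filter_upwards [eventually_ge_atTop ⌈(1 - b) / a⌉₊] with r hr
  have hx : 1 ≤ a * r + b := by
    have : (1 - b) / a ≤ r := (Nat.le_ceil _).trans (by exact_mod_cast hr)
    rw [div_le_iff₀ ha] at this
    linarith
  have hG := rpow_mul_exp_le_Gamma hR hx
  have hpos : 0 < R ^ (a * r + b - 1) * Real.exp (-(R + 1)) := by positivity
  have hcoef : ‖mlCoeff a b r‖ ≤ (R ^ (a * r + b - 1) * Real.exp (-(R + 1)))⁻¹ := by
    rw [mlCoeff, norm_inv, Complex.Gamma_ofReal, Complex.norm_real, Real.norm_eq_abs,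
      abs_of_pos (hpos.trans_le hG)]
    exact inv_anti₀ hpos hG
  rw [Real.norm_of_nonneg (by positivity)]
  calc ρ ^ r * ‖mlCoeff a b r‖
      ≤ ρ ^ r * (R ^ (a * r + b - 1) * Real.exp (-(R + 1)))⁻¹ := by gcongr
    _ = Real.exp (R + 1) * R ^ (1 - b) * (ρ / (2 * ρ + 1)) ^ r := by
        have : R ^ (a * r + b - 1) = (2 * ρ + 1) ^ r * (R ^ (1 - b))⁻¹ := by
          rw [← Real.rpow_neg hR.le, ← hRa, ← Real.rpow_natCast, ← Real.rpow_mul hR.le,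
            ← Real.rpow_add hR]
          ring_nf
        rw [this, Real.exp_neg, div_pow]
        field_simp
    _ ≤ _ := by
        have : ρ / (2 * ρ + 1) ≤ 1 / 2 := by
          rw [div_le_div_iff₀ (by positivity) (by norm_num)]
          linarith
        gcongr

lemma summable_mittagLeffler {a : ℝ} (ha : 0 < a) (b : ℝ) (z : ℂ) :
    Summable fun r : ℕ => z ^ r * mlCoeff a b r := by
  refine Summable.of_norm ?_
  simpa using summable_pow_mul_norm_mlCoeff ha b (norm_nonneg z)

lemma mittagLeffler_ball_bound (a b ρ : ℝ) (r : ℕ) (w : ℂ) (hw : w ∈ Metric.ball (0 : ℂ) ρ) :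
    ‖w ^ r * mlCoeff a b r‖ ≤ ρ ^ r * ‖mlCoeff a b r‖ := by
  rw [norm_mul, norm_pow]
  have : ‖w‖ ≤ ρ := by simpa using (mem_ball_zero_iff.1 hw).le
  gcongr

lemma differentiable_mittagLeffler {a : ℝ} (ha : 0 < a) (b : ℝ) :
    Differentiable ℂ (mittagLeffler a b) := by
  intro z
  have h : DifferentiableOn ℂ (fun w : ℂ => ∑' r : ℕ, w ^ r * mlCoeff a b r)
      (Metric.ball 0 (‖z‖ + 1)) :=
    Complex.differentiableOn_tsum_of_summable_norm
      (summable_pow_mul_norm_mlCoeff ha b (by positivity)) (fun r => by fun_prop)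
      Metric.isOpen_ball (mittagLeffler_ball_bound a b _)
  have : mittagLeffler a b = fun w : ℂ => ∑' r : ℕ, w ^ r * mlCoeff a b r :=
    funext (mittagLeffler_eq_tsum a b)
  rw [this]
  exact h.differentiableAt (Metric.isOpen_ball.mem_nhds (by simp))

/-- The factor `z` in front of the derivative keeps the powers unshifted, so that this series
combines termwise with the original one in the differential equation for `a = 1`. -/
lemma hasSum_deriv_mittagLeffler {a : ℝ} (ha : 0 < a) (b : ℝ) (z : ℂ) :
    HasSum (fun r : ℕ => r * z ^ r * mlCoeff a b r) (z * deriv (mittagLeffler a b) z) := by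
  have h := Complex.hasSum_deriv_of_summable_norm
      (F := fun (r : ℕ) (w : ℂ) => w ^ r * mlCoeff a b r)
      (summable_pow_mul_norm_mlCoeff ha b (ρ := ‖z‖ + 1) (by positivity)) (fun r => by fun_prop)
      Metric.isOpen_ball (mittagLeffler_ball_bound a b _) (z := z) (by simp)
  have e : (fun w : ℂ => ∑' r : ℕ, w ^ r * mlCoeff a b r) = mittagLeffler a b :=
    (funext (mittagLeffler_eq_tsum a b)).symm
  rw [e] at h
  refine (h.mul_left z).congr_fun ?_
  intro r
  simp only [deriv_mul_const_field, deriv_pow_field]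
  rcases r with _ | r
  · simp
  · simp only [Nat.add_sub_cancel, pow_succ]
    ring

lemma mittagLeffler_conj (a b : ℝ) (z : ℂ) :
    mittagLeffler a b (starRingEnd ℂ z) = starRingEnd ℂ (mittagLeffler a b z) := by
  simp [mittagLeffler_eq_tsum, mlCoeff, Complex.conj_tsum, ← Complex.Gamma_conj]

lemma exists_norm_mittagLeffler_le_of_norm_le_one {a : ℝ} (ha : 0 < a) (b : ℝ) :
    ∃ C : ℝ, 0 < C ∧ ∀ w : ℂ, ‖w‖ ≤ 1 → ‖mittagLeffler a b w‖ ≤ C / (1 + ‖w‖) := by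
  obtain ⟨C, hC⟩ := (isCompact_closedBall (0 : ℂ) 1).exists_bound_of_continuousOn
    (differentiable_mittagLeffler ha b).continuous.continuousOn
  refine ⟨2 * (|C| + 1), by positivity, fun w hw => ?_⟩
  rw [le_div_iff₀ (by positivity), mul_comm]
  have h1 := hC w (by simpa using hw)
  have h2 := le_abs_self C
  nlinarith [norm_nonneg w, norm_nonneg (mittagLeffler a b w), abs_nonneg C]

/-! ### The Gamma integral along a ray -/

lemma integrableOn_rpow_mul_exp_neg_mul {s b : ℝ} (hs : -1 < s) (hb : 0 < b) :
    IntegrableOn (fun x : ℝ => x ^ s * Real.exp (-b * x)) (Set.Ioi 0) := by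
  simpa using integrableOn_rpow_mul_exp_neg_mul_rpow (p := 1) hs one_pos hb

lemma norm_cexp_ofReal_mul (x : ℝ) (d : ℂ) : ‖Complex.exp (x * d)‖ = Real.exp (x * d.re) := by
  simp [Complex.norm_exp]

lemma measurable_rpow_mul_cexp (b : ℝ) (d : ℂ) :
    Measurable fun x : ℝ => ((x ^ b : ℝ) : ℂ) * Complex.exp (x * d) := by
  fun_prop

lemma differentiableOn_integral_rpow_mul_cexp {b : ℝ} (hb : 0 < b) :
    DifferentiableOn ℂ
      (fun d : ℂ => ∫ x in Set.Ioi (0 : ℝ), ((x ^ (b - 1) : ℝ) : ℂ) * Complex.exp (x * d))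
      {d | d.re < 0} := by
  intro d hd
  have hd : d.re < 0 := hd
  have hint : Integrable (fun x : ℝ => x ^ b * Real.exp (-(-d.re / 2) * x))
      (volume.restrict (Set.Ioi 0)) :=
    integrableOn_rpow_mul_exp_neg_mul (by linarith) (by linarith)
  have hint0 : Integrable (fun x : ℝ => x ^ (b - 1) * Real.exp (-(-d.re) * x))
      (volume.restrict (Set.Ioi 0)) :=
    integrableOn_rpow_mul_exp_neg_mul (by linarith) (by linarith)
  have hs : {w : ℂ | w.re < d.re / 2} ∈ 𝓝 d :=
    (isOpen_lt Complex.continuous_re continuous_const).mem_nhds (show d.re < d.re / 2 by linarith)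
  refine (hasDerivAt_integral_of_dominated_loc_of_deriv_le
    (F' := fun w x => ((x ^ b : ℝ) : ℂ) * Complex.exp (x * w)) hs
    (Eventually.of_forall fun w => (measurable_rpow_mul_cexp _ w).aestronglyMeasurable) ?_
    (measurable_rpow_mul_cexp b d).aestronglyMeasurable ?_ hint
    ?_).2.differentiableAt.differentiableWithinAt
  · refine hint0.mono (measurable_rpow_mul_cexp _ d).aestronglyMeasurable ?_
    filter_upwards with x
    rw [norm_mul, norm_cexp_ofReal_mul, norm_mul, Complex.norm_real,
      Real.norm_of_nonneg (Real.exp_pos _).le]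
    ring_nf
    rfl
  · filter_upwards [ae_restrict_mem measurableSet_Ioi] with x hx w hw
    have hx : 0 < x := hx
    have hw : w.re < d.re / 2 := hw
    rw [norm_mul, norm_cexp_ofReal_mul, Complex.norm_real, Real.norm_of_nonneg (by positivity)]
    have : x * w.re ≤ -(-d.re / 2) * x := by nlinarith
    gcongr
  · filter_upwards [ae_restrict_mem measurableSet_Ioi] with x hx w _
    have hx : 0 < x := hx
    have h : HasDerivAt (fun w : ℂ => ((x ^ (b - 1) : ℝ) : ℂ) * Complex.exp (x * w))
        (((x ^ (b - 1) : ℝ) : ℂ) * (Complex.exp (x * w) * (x * 1))) w :=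
      (((hasDerivAt_id w).const_mul (x : ℂ)).cexp).const_mul _
    convert! h using 1
    have : x ^ b = x ^ (b - 1) * x := by
      rw [← Real.rpow_add_one hx.ne']
      ring_nf
    rw [this]
    push_cast
    ring

/-- Both sides are analytic in the half plane `Re d < 0` and agree on the negative real axis by
Euler's integral, so the identity theorem applies. -/
lemma integral_rpow_mul_cexp {b : ℝ} (hb : 0 < b) {d : ℂ} (hd : d.re < 0) :
    ∫ x in Set.Ioi (0 : ℝ), ((x ^ (b - 1) : ℝ) : ℂ) * Complex.exp (x * d) =
      (-d) ^ (-b : ℂ) * Complex.Gamma b := by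
  have hopen : IsOpen {d : ℂ | d.re < 0} := isOpen_lt Complex.continuous_re continuous_const
  have h1 := (differentiableOn_integral_rpow_mul_cexp hb).analyticOnNhd hopen
  have h2 : AnalyticOnNhd ℂ (fun d : ℂ => (-d) ^ (-b : ℂ) * Complex.Gamma b) {d | d.re < 0} := by
    refine DifferentiableOn.analyticOnNhd (fun w hw => ?_) hopen
    refine DifferentiableAt.differentiableWithinAt (DifferentiableAt.mul_const ?_ _)
    refine (differentiableAt_id.neg).cpow_const (Or.inl ?_)
    have hw : w.re < 0 := hw
    simpa using hw
  have hconv : IsPreconnected {d : ℂ | d.re < 0} := (convex_halfSpace_re_lt 0).isPreconnected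
  refine h1.eqOn_of_preconnected_of_frequently_eq h2 hconv (z₀ := -1) (by simp) ?_ hd
  have htend : Tendsto (fun r : ℝ => -(r : ℂ)) (𝓝[>] 1) (𝓝[≠] (-1)) := by
    refine tendsto_nhdsWithin_iff.2 ⟨?_, ?_⟩
    · have : Continuous fun r : ℝ => -(r : ℂ) := by fun_prop
      simpa using (this.tendsto 1).mono_left nhdsWithin_le_nhds
    · filter_upwards [self_mem_nhdsWithin] with r hr
      have hr : (1 : ℝ) < r := hr
      simp only [Set.mem_compl_iff, Set.mem_singleton_iff, neg_inj]
      exact_mod_cast hr.ne'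
  refine htend.frequently (Eventually.frequently ?_)
  filter_upwards [self_mem_nhdsWithin] with r hr
  have hr0 : (0 : ℝ) < r := lt_trans one_pos hr
  have h := Complex.integral_cpow_mul_exp_neg_mul_Ioi (a := b) (r := r) (by simpa using hb) hr0
  rw [neg_neg, Complex.cpow_neg, ← Complex.inv_cpow, ← one_div, ← h]
  · refine setIntegral_congr_fun measurableSet_Ioi fun x hx => ?_
    have hx : (0 : ℝ) < x := hx
    rw [Complex.ofReal_cpow hx.le]
    push_cast
    ring_nf
  · rw [Complex.arg_ofReal_of_nonneg hr0.le]
    exact Real.pi_pos.ne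

/-! ### The integrand `e ^ s * s ^ p` along the ray `1 + x d` -/

lemma integrableOn_one_add_rpow_mul_exp_neg_mul (B : ℝ) {μ : ℝ} (hμ : 0 < μ) :
    IntegrableOn (fun x : ℝ => (1 + x) ^ B * Real.exp (-μ * x)) (Set.Ioi 0) := by
  refine integrable_of_isBigO_exp_neg (b := μ / 2) (by positivity) ?_ ?_
  · refine ContinuousOn.mul (ContinuousOn.rpow_const (by fun_prop) ?_) (by fun_prop)
    intro x hx
    have : (0 : ℝ) ≤ x := hx
    left; positivity
  · have h := (isLittleO_rpow_exp_pos_mul_atTop B (b := μ / 2) (by positivity)).comp_tendsto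
      (tendsto_atTop_add_const_left atTop (1 : ℝ) tendsto_id)
    have h2 := h.isBigO.mul
      (Asymptotics.isBigO_refl (fun x : ℝ => Real.exp (-μ * x)) atTop)
    refine h2.trans (Asymptotics.IsBigO.of_bound (Real.exp (μ / 2)) ?_)
    filter_upwards with x
    simp only [Function.comp, id, Real.norm_eq_abs, abs_mul, Real.abs_exp]
    rw [← Real.exp_add, ← Real.exp_add]
    apply le_of_eq
    ring_nf

section ray
variable {d : ℂ}

/-- `|d.im|` is the distance from `0` to the line through `1` in direction `d`; it keeps the ray
away from the singularity of `s ^ p`. -/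
lemma abs_im_le_norm_one_add_mul (hd : ‖d‖ = 1) (x : ℝ) : |d.im| ≤ ‖1 + x * d‖ := by
  have h : ((1 + x * d) * starRingEnd ℂ d).im = -d.im := by
    simp [Complex.add_im, Complex.mul_im]
    ring
  calc |d.im| = |((1 + x * d) * starRingEnd ℂ d).im| := by rw [h, abs_neg]
    _ ≤ ‖(1 + x * d) * starRingEnd ℂ d‖ := Complex.abs_im_le_norm _
    _ = ‖1 + x * d‖ := by simp [hd]

lemma norm_add_mul_le (hd : ‖d‖ = 1) {a x : ℝ} (ha : 0 ≤ a) (ha1 : a ≤ 1) (hx : 0 ≤ x) :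
    ‖(a : ℂ) + x * d‖ ≤ 1 + x := by
  refine (norm_add_le _ _).trans ?_
  simp only [Complex.norm_real, Real.norm_eq_abs, norm_mul, hd, abs_of_nonneg ha, abs_of_nonneg hx]
  linarith

/-- One majorant for all exponents with `|p| ≤ B`, as dominated convergence in `p` requires. -/
lemma rpow_norm_one_add_mul_le (hd : ‖d‖ = 1) (him : d.im ≠ 0) {p B x : ℝ} (hp : |p| ≤ B)
    (hx : 0 ≤ x) : ‖1 + x * d‖ ^ p ≤ |d.im| ^ (-B) * (1 + x) ^ B := by
  have h0 : 0 < |d.im| := abs_pos.2 him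
  have h1 : |d.im| ≤ 1 := hd ▸ Complex.abs_im_le_norm d
  have hlow := abs_im_le_norm_one_add_mul hd x
  have hup : ‖1 + x * d‖ ≤ 1 + x := by
    simpa using norm_add_mul_le hd zero_le_one le_rfl hx
  have hB : 0 ≤ B := (abs_nonneg p).trans hp
  rcases le_total 0 p with h | h
  · calc ‖1 + x * d‖ ^ p ≤ (1 + x) ^ p := by gcongr
      _ ≤ (1 + x) ^ B := Real.rpow_le_rpow_of_exponent_le (by linarith) ((le_abs_self p).trans hp)
      _ ≤ |d.im| ^ (-B) * (1 + x) ^ B :=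
        le_mul_of_one_le_left (by positivity)
          (Real.one_le_rpow_of_pos_of_le_one_of_nonpos h0 h1 (by linarith))
  · calc ‖1 + x * d‖ ^ p ≤ |d.im| ^ p := Real.rpow_le_rpow_of_nonpos h0 hlow h
      _ ≤ |d.im| ^ (-B) := Real.rpow_le_rpow_of_exponent_ge h0 h1 (neg_le_of_abs_le hp)
      _ ≤ |d.im| ^ (-B) * (1 + x) ^ B :=
        le_mul_of_one_le_right (by positivity) (Real.one_le_rpow (by linarith) hB)

lemma norm_cexp_add_mul (a x : ℝ) :
    ‖Complex.exp (a + x * d)‖ = Real.exp a * Real.exp (-(-d.re) * x) := by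
  rw [Complex.norm_exp, ← Real.exp_add]
  simp
  ring

lemma norm_cexp_mul_cpow_le (hd : ‖d‖ = 1) (him : d.im ≠ 0) {p B x : ℝ} (hp : |p| ≤ B)
    (hx : 0 ≤ x) : ‖Complex.exp (1 + x * d) * (1 + x * d) ^ (p : ℂ)‖ ≤
      Real.exp 1 * |d.im| ^ (-B) * ((1 + x) ^ B * Real.exp (-(-d.re) * x)) := by
  have h := norm_cexp_add_mul (d := d) 1 x
  rw [Complex.ofReal_one] at h
  rw [norm_mul, Complex.norm_cpow_real, h]
  calc _ ≤ Real.exp 1 * Real.exp (-(-d.re) * x) * (|d.im| ^ (-B) * (1 + x) ^ B) := by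
        gcongr
        exact rpow_norm_one_add_mul_le hd him hp hx
    _ = _ := by ring

lemma measurable_cexp_mul_cpow (a p : ℝ) :
    Measurable fun x : ℝ => Complex.exp (a + x * d) * (a + x * d) ^ (p : ℂ) := by
  fun_prop

lemma integrableOn_cexp_mul_cpow (hd : ‖d‖ = 1) (hre : d.re < 0) (him : d.im ≠ 0) (p : ℝ) :
    IntegrableOn (fun x : ℝ => Complex.exp (1 + x * d) * (1 + x * d) ^ (p : ℂ)) (Set.Ioi 0) := by
  refine Integrable.mono' ((integrableOn_one_add_rpow_mul_exp_neg_mul |p|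
    (neg_pos.2 hre)).const_mul (Real.exp 1 * |d.im| ^ (-|p|))) ?_ ?_
  · simpa using (measurable_cexp_mul_cpow (d := d) 1 p).aestronglyMeasurable
  · filter_upwards [ae_restrict_mem measurableSet_Ioi] with x hx
    exact norm_cexp_mul_cpow_le hd him le_rfl (le_of_lt hx)

lemma add_mul_mem_slitPlane (him : d.im ≠ 0) {a x : ℝ} (h : 0 < a ∨ x ≠ 0) :
    (a : ℂ) + x * d ∈ Complex.slitPlane := by
  rcases eq_or_ne x 0 with rfl | hx
  · have : 0 < a := h.resolve_right (by simp)
    exact Or.inl (by simpa using this)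
  · right
    simpa using ⟨hx, him⟩

lemma hasDerivAt_cexp_mul_cpow (p : ℝ) {s : ℂ} (hs : s ∈ Complex.slitPlane) :
    HasDerivAt (fun s => Complex.exp s * s ^ (p : ℂ))
      (Complex.exp s * s ^ (p : ℂ) + p * (Complex.exp s * s ^ ((p - 1 : ℝ) : ℂ))) s := by
  have h := (Complex.hasDerivAt_exp s).mul ((hasDerivAt_id s).cpow_const (c := (p : ℂ)) hs)
  convert! h using 1
  simp
  ring

lemma hasDerivAt_cexp_mul_cpow_ray (him : d.im ≠ 0) (p : ℝ) {a x : ℝ} (h : 0 < a ∨ x ≠ 0) :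
    HasDerivAt (fun x : ℝ => Complex.exp (a + x * d) * (a + x * d) ^ (p : ℂ))
      ((Complex.exp (a + x * d) * (a + x * d) ^ (p : ℂ) +
        p * (Complex.exp (a + x * d) * (a + x * d) ^ ((p - 1 : ℝ) : ℂ))) * d) x := by
  have h1 := hasDerivAt_cexp_mul_cpow p (add_mul_mem_slitPlane him h)
  have h2 : HasDerivAt (fun x : ℝ => (a : ℂ) + x * d) d x := by
    simpa using ((Complex.ofRealCLM.hasDerivAt (x := x)).mul_const d).const_add (a : ℂ)
  exact h1.comp x h2

/-- The bound is uniform in the starting point `a`, including `a = 0` where the ray starts at the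
singularity; hence `0 ≤ p`. -/
lemma norm_cexp_add_mul_cpow_le (hd : ‖d‖ = 1) {a p x : ℝ} (hp : 0 ≤ p)
    (ha : 0 ≤ a) (ha1 : a ≤ 1) (hx : 0 ≤ x) :
    ‖Complex.exp (a + x * d) * (a + x * d) ^ (p : ℂ)‖ ≤
      Real.exp 1 * ((1 + x) ^ p * Real.exp (-(-d.re) * x)) := by
  rw [norm_mul, Complex.norm_cpow_real, norm_cexp_add_mul]
  calc _ ≤ Real.exp 1 * Real.exp (-(-d.re) * x) * (1 + x) ^ p := by
        gcongr
        exact norm_add_mul_le hd ha ha1 hx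
    _ = _ := by ring

lemma integrableOn_cexp_add_mul_cpow (hd : ‖d‖ = 1) (hre : d.re < 0) {a p : ℝ} (hp : 0 ≤ p)
    (ha : 0 ≤ a) (ha1 : a ≤ 1) :
    IntegrableOn (fun x : ℝ => Complex.exp (a + x * d) * (a + x * d) ^ (p : ℂ)) (Set.Ioi 0) := by
  refine Integrable.mono' ((integrableOn_one_add_rpow_mul_exp_neg_mul p
    (neg_pos.2 hre)).const_mul (Real.exp 1)) (measurable_cexp_mul_cpow a p).aestronglyMeasurable ?_
  filter_upwards [ae_restrict_mem measurableSet_Ioi] with x hx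
  exact norm_cexp_add_mul_cpow_le hd hp ha ha1 (le_of_lt hx)

/-- Fundamental theorem of calculus for `e ^ s * s ^ p` along a ray starting on the positive
real axis. -/
lemma integral_deriv_cexp_mul_cpow_ray (him : d.im ≠ 0) (p : ℝ) {a : ℝ} (ha : 0 < a)
    (h1 : IntegrableOn (fun x : ℝ => Complex.exp (a + x * d) * (a + x * d) ^ (p : ℂ)) (Set.Ioi 0))
    (h2 : IntegrableOn (fun x : ℝ => Complex.exp (a + x * d) * (a + x * d) ^ ((p - 1 : ℝ) : ℂ))
      (Set.Ioi 0)) :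
    ∫ x in Set.Ioi (0 : ℝ), (Complex.exp (a + x * d) * (a + x * d) ^ (p : ℂ) +
        p * (Complex.exp (a + x * d) * (a + x * d) ^ ((p - 1 : ℝ) : ℂ))) * d =
      -(Complex.exp a * a ^ (p : ℂ)) := by
  have hder : ∀ x ∈ Set.Ici (0 : ℝ), HasDerivAt _ _ x := fun x _ =>
    hasDerivAt_cexp_mul_cpow_ray (d := d) him p (x := x) (Or.inl ha)
  have hint : IntegrableOn (fun x : ℝ => (Complex.exp (a + x * d) * (a + x * d) ^ (p : ℂ) +
        p * (Complex.exp (a + x * d) * (a + x * d) ^ ((p - 1 : ℝ) : ℂ))) * d) (Set.Ioi 0) :=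
    (h1.add (h2.const_mul _)).mul_const d
  rw [integral_Ioi_of_hasDerivAt_of_tendsto' hder hint
    (tendsto_zero_of_hasDerivAt_of_integrableOn_Ioi (fun x hx => hder x (Set.Ioi_subset_Ici_self hx)) hint h1)]
  simp

end ray

/-! ### Hankel's formula for the reciprocal Gamma function -/

section ray
variable {d : ℂ}

lemma continuousOn_cexp_mul_cpow_translate (him : d.im ≠ 0) (p : ℝ) {x : ℝ} (hx : 0 < x) :
    ContinuousOn (fun a : ℝ => Complex.exp (a + x * d) * (a + x * d) ^ (p : ℂ))
      (Set.Icc 0 1) := by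
  intro a _
  have h := (hasDerivAt_cexp_mul_cpow p
    (add_mul_mem_slitPlane him (a := a) (Or.inr hx.ne'))).continuousAt
  have h2 : ContinuousAt (fun a : ℝ => (a : ℂ) + x * d) a := by fun_prop
  exact (ContinuousAt.comp (f := fun a : ℝ => (a : ℂ) + x * d) h h2).continuousWithinAt

lemma integral_deriv_cexp_mul_cpow_translate (him : d.im ≠ 0) (p : ℝ) {x : ℝ} (hx : 0 < x) :
    ∫ a in Set.Ioc (0 : ℝ) 1, (Complex.exp (a + x * d) * (a + x * d) ^ (p : ℂ) +
        p * (Complex.exp (a + x * d) * (a + x * d) ^ ((p - 1 : ℝ) : ℂ))) =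
      Complex.exp (1 + x * d) * (1 + x * d) ^ (p : ℂ) -
        Complex.exp (x * d) * (x * d) ^ (p : ℂ) := by
  rw [← intervalIntegral.integral_of_le zero_le_one]
  have hder : ∀ a ∈ Set.uIcc (0 : ℝ) 1,
      HasDerivAt (fun a : ℝ => Complex.exp (a + x * d) * (a + x * d) ^ (p : ℂ))
        (Complex.exp (a + x * d) * (a + x * d) ^ (p : ℂ) +
        p * (Complex.exp (a + x * d) * (a + x * d) ^ ((p - 1 : ℝ) : ℂ))) a := by
    intro a _
    have h1 := hasDerivAt_cexp_mul_cpow p (add_mul_mem_slitPlane him (a := a) (Or.inr hx.ne'))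
    have h2 : HasDerivAt (fun a : ℝ => (a : ℂ) + x * d) 1 a :=
      (Complex.ofRealCLM.hasDerivAt (x := a)).add_const _
    simpa only [mul_one] using! h1.comp a h2
  rw [intervalIntegral.integral_eq_sub_of_hasDerivAt hder]
  · simp
  · refine ContinuousOn.intervalIntegrable ?_
    rw [Set.uIcc_of_le zero_le_one]
    exact (continuousOn_cexp_mul_cpow_translate him p hx).add
      (continuousOn_const.mul (continuousOn_cexp_mul_cpow_translate him (p - 1) hx))

/-- A form of Cauchy's theorem on the half strip of points `a + x d`: the derivative of `e ^ s * s ^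
p` is integrated in both orders. Integrating over `a` first gives the difference of the two rays,
over `x` first the segment from `0` to `1`. The condition on `p` keeps `s ^ (p - 1)` bounded near
the corner `0`. -/
lemma integral_ray_one_sub_integral_ray_zero (hd : ‖d‖ = 1) (hre : d.re < 0) (him : d.im ≠ 0)
    {p : ℝ} (hp : 1 < p) :
    ((∫ x in Set.Ioi (0 : ℝ), Complex.exp (1 + x * d) * (1 + x * d) ^ (p : ℂ)) -
      ∫ x in Set.Ioi (0 : ℝ), Complex.exp (x * d) * (x * d) ^ (p : ℂ)) * d =
      -∫ a in Set.Ioc (0 : ℝ) 1, Complex.exp a * (a : ℂ) ^ (p : ℂ) := by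
  have hi := fun {a : ℝ} (ha : 0 ≤ a) (ha1 : a ≤ 1) =>
    integrableOn_cexp_add_mul_cpow hd hre (p := p) (by linarith) ha ha1
  have hi' := fun {a : ℝ} (ha : 0 ≤ a) (ha1 : a ≤ 1) =>
    integrableOn_cexp_add_mul_cpow hd hre (p := p - 1) (by linarith) ha ha1
  have hdom : Integrable (Function.uncurry fun a x : ℝ =>
      Complex.exp (a + x * d) * (a + x * d) ^ (p : ℂ) +
        p * (Complex.exp (a + x * d) * (a + x * d) ^ ((p - 1 : ℝ) : ℂ)))
      ((volume.restrict (Set.Ioc (0 : ℝ) 1)).prod (volume.restrict (Set.Ioi (0 : ℝ)))) := by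
    have hb : Integrable (fun x : ℝ => Real.exp 1 * ((1 + x) ^ p * Real.exp (-(-d.re) * x)) +
        p * (Real.exp 1 * ((1 + x) ^ (p - 1) * Real.exp (-(-d.re) * x))))
        (volume.restrict (Set.Ioi (0 : ℝ))) :=
      ((integrableOn_one_add_rpow_mul_exp_neg_mul p (neg_pos.2 hre)).const_mul _).add
        (((integrableOn_one_add_rpow_mul_exp_neg_mul (p - 1) (neg_pos.2 hre)).const_mul _).const_mul
          _)
    refine (hb.comp_snd (volume.restrict (Set.Ioc (0 : ℝ) 1))).mono' ?_ ?_
    · refine Measurable.aestronglyMeasurable ?_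
      unfold Function.uncurry
      fun_prop
    · rw [Measure.prod_restrict]
      filter_upwards [ae_restrict_mem (measurableSet_Ioc.prod measurableSet_Ioi)] with q hq
      obtain ⟨⟨h1, h2⟩, h3⟩ := hq
      refine (norm_add_le _ _).trans (add_le_add ?_ ?_)
      · exact norm_cexp_add_mul_cpow_le hd (by linarith) h1.le h2 (le_of_lt h3)
      · rw [norm_mul, Complex.norm_real, Real.norm_of_nonneg (by linarith)]
        gcongr
        exact norm_cexp_add_mul_cpow_le hd (by linarith) h1.le h2 (le_of_lt h3)
  have h1 := hi zero_le_one le_rfl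
  have h0 := hi le_rfl zero_le_one
  simp only [Complex.ofReal_one, Complex.ofReal_zero, zero_add] at h1 h0
  rw [← integral_sub h1 h0, ← integral_neg]
  rw [setIntegral_congr_fun measurableSet_Ioi fun x hx =>
    (integral_deriv_cexp_mul_cpow_translate him p hx).symm]
  rw [← integral_integral_swap hdom, ← integral_mul_const]
  refine setIntegral_congr_fun measurableSet_Ioc fun a ha => ?_
  rw [← integral_mul_const]
  exact integral_deriv_cexp_mul_cpow_ray him p ha.1 (hi ha.1.le ha.2) (hi' ha.1.le ha.2)

/-- The integral of `e ^ s * s ^ p` along the ray from `1` in the direction `d`. -/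
noncomputable def hankelRay (d : ℂ) (p : ℝ) : ℂ :=
  ∫ x in Set.Ioi (0 : ℝ), Complex.exp (1 + x * d) * (1 + x * d) ^ (p : ℂ) * d

/-- Integration by parts. The boundary term does not depend on `d`, so it cancels between two rays
and leaves the functional equation of `1 / Γ`. -/
lemma hankelRay_add (hd : ‖d‖ = 1) (hre : d.re < 0) (him : d.im ≠ 0) (p : ℝ) :
    hankelRay d p + p * hankelRay d (p - 1) = -Complex.exp 1 := by
  have h1 := integrableOn_cexp_mul_cpow hd hre him p
  have h2 := integrableOn_cexp_mul_cpow hd hre him (p - 1)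
  have h := integral_deriv_cexp_mul_cpow_ray (a := 1) him p one_pos (by simpa using h1)
    (by simpa using h2)
  simp only [Complex.ofReal_one, Complex.one_cpow, mul_one] at h
  rw [← h, integral_mul_const, integral_add h1 (h2.const_mul _), integral_const_mul, hankelRay,
    hankelRay, integral_mul_const, integral_mul_const]
  ring

lemma continuous_hankelRay (hd : ‖d‖ = 1) (hre : d.re < 0) (him : d.im ≠ 0) :
    Continuous (hankelRay d) := by
  rw [continuous_iff_continuousAt]
  intro p
  unfold hankelRay
  simp_rw [integral_mul_const]
  refine ContinuousAt.mul ?_ continuousAt_const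
  refine continuousAt_of_dominated (bound := fun x => Real.exp 1 * |d.im| ^ (-(|p| + 1)) *
    ((1 + x) ^ (|p| + 1) * Real.exp (-(-d.re) * x))) ?_ ?_ ?_ ?_
  · filter_upwards with q
    simpa using (measurable_cexp_mul_cpow (d := d) 1 q).aestronglyMeasurable
  · have : ∀ᶠ q in 𝓝 p, |q| < |p| + 1 :=
      (continuous_abs.tendsto p).eventually (gt_mem_nhds (by linarith))
    filter_upwards [this] with q hq
    filter_upwards [ae_restrict_mem measurableSet_Ioi] with x hx
    exact norm_cexp_mul_cpow_le hd him hq.le (le_of_lt hx)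
  · exact (integrableOn_one_add_rpow_mul_exp_neg_mul _ (neg_pos.2 hre)).const_mul _
  · filter_upwards with x
    have h0 : (1 : ℂ) + x * d ≠ 0 := by
      have := add_mul_mem_slitPlane him (a := 1) (x := x) (Or.inl one_pos)
      simpa using Complex.slitPlane_ne_zero this
    refine ContinuousAt.mul continuousAt_const (ContinuousAt.const_cpow (by fun_prop) (Or.inl h0))

end ray

/-- The sign `e` selects the upper or lower ray. The Gamma integral contributes the phase of `(-d) ^
(-(p + 1))`, where `-d` has argument `e (δ - π)`; together with the phase of `d ^ (p + 1)` the angle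
`δ` drops out. -/
lemma integral_ray_zero {δ : ℝ} (h1 : Real.pi / 2 < δ) (h2 : δ < Real.pi) {p : ℝ} (hp : 0 ≤ p)
    {e : ℝ} (he : e = 1 ∨ e = -1) :
    (∫ x in Set.Ioi (0 : ℝ), Complex.exp (x * Complex.exp (e * δ * Complex.I)) *
        (x * Complex.exp (e * δ * Complex.I)) ^ (p : ℂ)) * Complex.exp (e * δ * Complex.I) =
      Complex.exp (e * Real.pi * (p + 1) * Complex.I) * Complex.Gamma (p + 1) := by
  set d := Complex.exp (e * δ * Complex.I) with hd
  have hπ := Real.pi_pos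
  have hlog : Complex.log d = e * δ * Complex.I := by
    rw [hd, Complex.log_exp] <;> rcases he with rfl | rfl <;> simp <;> linarith
  have hneg : -d = Complex.exp (e * (δ - Real.pi) * Complex.I) := by
    rw [hd]
    rcases he with rfl | rfl <;> simp [sub_mul, Complex.exp_sub, neg_mul, Complex.exp_neg, div_neg,
      neg_div]
  have hlogneg : Complex.log (-d) = e * (δ - Real.pi) * Complex.I := by
    rw [hneg, Complex.log_exp] <;> rcases he with rfl | rfl <;> simp <;> linarith
  have hre : d.re < 0 := by
    have : d.re = Real.cos δ := by
      rw [hd, ← Complex.ofReal_mul, Complex.exp_ofReal_mul_I_re]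
      rcases he with rfl | rfl <;> simp
    rw [this]
    exact Real.cos_neg_of_pi_div_two_lt_of_lt h1 (by linarith)
  have hd0 : d ≠ 0 := Complex.exp_ne_zero _
  have key := integral_rpow_mul_cexp (b := p + 1) (by linarith) hre
  rw [Complex.cpow_def_of_ne_zero (neg_ne_zero.2 hd0), hlogneg] at key
  have hstep : ∫ x in Set.Ioi (0 : ℝ), Complex.exp (x * d) * (x * d) ^ (p : ℂ) =
      (∫ x in Set.Ioi (0 : ℝ), ((x ^ (p + 1 - 1) : ℝ) : ℂ) * Complex.exp (x * d)) *
        Complex.exp (e * δ * Complex.I * p) := by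
    rw [← integral_mul_const]
    refine setIntegral_congr_fun measurableSet_Ioi fun x hx => ?_
    have hx : (0 : ℝ) < x := hx
    have hx0 : (x : ℂ) ≠ 0 := by exact_mod_cast hx.ne'
    have : ((x : ℂ) * d) ^ (p : ℂ) = (x ^ p : ℝ) * Complex.exp (e * δ * Complex.I * p) := by
      rw [Complex.ofReal_cpow hx.le, Complex.cpow_def_of_ne_zero (mul_ne_zero hx0 hd0),
        Complex.log_ofReal_mul hx hd0, Complex.cpow_def_of_ne_zero hx0, hlog, add_mul,
        Complex.exp_add, Complex.ofReal_log hx.le]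
    simp only [this, add_sub_cancel_right]
    ring
  rw [hstep, key]
  have hcomb : Complex.exp (e * Real.pi * (p + 1) * Complex.I) =
      Complex.exp (e * (δ - Real.pi) * Complex.I * -((p + 1 : ℝ) : ℂ)) *
        Complex.exp (e * δ * Complex.I * p) * d := by
    rw [hd, ← Complex.exp_add, ← Complex.exp_add]
    push_cast
    ring_nf
  rw [hcomb]
  push_cast
  ring

/-- Hankel's formula for the reciprocal Gamma function. -/
lemma hankelRay_sub_hankelRay {δ : ℝ} (h1 : Real.pi / 2 < δ) (h2 : δ < Real.pi) (p : ℝ) :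
    hankelRay (Complex.exp (δ * Complex.I)) p - hankelRay (Complex.exp (-δ * Complex.I)) p =
      2 * Real.pi * Complex.I * (Complex.Gamma (-p : ℝ))⁻¹ := by
  set d₁ := Complex.exp (δ * Complex.I) with hd₁
  set d₂ := Complex.exp (-δ * Complex.I) with hd₂
  have hπ := Real.pi_pos
  have n1 : ‖d₁‖ = 1 := Complex.norm_exp_ofReal_mul_I δ
  have n2 : ‖d₂‖ = 1 := by
    have := Complex.norm_exp_ofReal_mul_I (-δ)
    rwa [Complex.ofReal_neg] at this
  have hcos : Real.cos δ < 0 := Real.cos_neg_of_pi_div_two_lt_of_lt h1 (by linarith)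
  have hsin : 0 < Real.sin δ := Real.sin_pos_of_pos_of_lt_pi (by linarith) h2
  have r1 : d₁.re < 0 := by rw [hd₁, Complex.exp_ofReal_mul_I_re]; exact hcos
  have i1 : d₁.im ≠ 0 := by rw [hd₁, Complex.exp_ofReal_mul_I_im]; exact hsin.ne'
  have r2 : d₂.re < 0 := by
    rw [hd₂, ← Complex.ofReal_neg, Complex.exp_ofReal_mul_I_re, Real.cos_neg]; exact hcos
  have i2 : d₂.im ≠ 0 := by
    rw [hd₂, ← Complex.ofReal_neg, Complex.exp_ofReal_mul_I_im, Real.sin_neg]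
    exact (neg_neg_of_pos hsin).ne
  -- Both rays are moved to the origin. The corrections along `(0, 1]` coincide and cancel, and the
  -- remaining phases give a sine, which the reflection formula turns into `1 / Γ(-q)`.
  have hbase : ∀ q : ℝ, 1 < q → hankelRay d₁ q - hankelRay d₂ q =
      2 * Real.pi * Complex.I * (Complex.Gamma (-q : ℝ))⁻¹ := by
    intro q hq
    have e1 := integral_ray_one_sub_integral_ray_zero n1 r1 i1 hq
    have e2 := integral_ray_one_sub_integral_ray_zero n2 r2 i2 hq
    have g1 := integral_ray_zero h1 h2 (p := q) (by linarith) (Or.inl rfl)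
    have g2 := integral_ray_zero h1 h2 (p := q) (by linarith) (Or.inr rfl)
    simp only [Complex.ofReal_one, one_mul, Complex.ofReal_neg, neg_mul] at g1 g2
    rw [← hd₁] at g1
    rw [neg_mul] at hd₂
    rw [← hd₂] at g2
    rw [sub_mul] at e1 e2
    have hrefl := Complex.Gamma_mul_Gamma_one_sub (-q : ℝ)
    have hG : Complex.Gamma (q + 1) ≠ 0 :=
      Complex.Gamma_ne_zero_of_re_pos (by simp; linarith)
    have hsin2 : Complex.exp (Real.pi * (q + 1) * Complex.I) -
        Complex.exp (-(Real.pi * (q + 1) * Complex.I)) =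
          2 * Complex.I * Complex.sin (Real.pi * (-q : ℝ)) := by
      have : (Real.pi : ℂ) * (-q : ℝ) = Real.pi - Real.pi * (q + 1) := by push_cast; ring
      rw [this, Complex.sin_pi_sub, Complex.sin]
      ring_nf
      simp
    have hgam : Complex.sin (Real.pi * (-q : ℝ)) * Complex.Gamma (q + 1) =
        Real.pi * (Complex.Gamma (-q : ℝ))⁻¹ := by
      have h1q : (1 : ℂ) - (-q : ℝ) = q + 1 := by push_cast; ring
      rw [h1q] at hrefl
      -- If the sine vanishes, `Γ(-q)` is at a pole, where its value and its inverse are both `0`.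
      by_cases hs : Complex.sin (Real.pi * (-q : ℝ)) = 0
      · rw [hs, div_zero] at hrefl
        rw [(mul_eq_zero.1 hrefl).resolve_right hG, hs]
        simp
      · rw [eq_div_iff hs] at hrefl
        have : Complex.Gamma (-q : ℝ) ≠ 0 := by
          intro h0
          rw [h0] at hrefl
          simp only [zero_mul] at hrefl
          exact hπ.ne' (Complex.ofReal_eq_zero.1 hrefl.symm)
        rw [eq_mul_inv_iff_mul_eq₀ this]
        linear_combination hrefl
    rw [hankelRay, hankelRay, integral_mul_const, integral_mul_const]
    linear_combination e1 - e2 + g1 - g2 + Complex.Gamma (q + 1) * hsin2 + 2 * Complex.I * hgam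
  have hcontL : Continuous fun q => hankelRay d₁ q - hankelRay d₂ q :=
    (continuous_hankelRay n1 r1 i1).sub (continuous_hankelRay n2 r2 i2)
  have hcontR : Continuous fun q : ℝ => 2 * Real.pi * Complex.I * (Complex.Gamma (-q : ℝ))⁻¹ := by
    have := Complex.differentiable_one_div_Gamma.continuous
    exact continuous_const.mul (this.comp (by fun_prop : Continuous fun q : ℝ => ((-q : ℝ) : ℂ)))
  -- The recursion carries the formula one unit to the left at each step. It involves division by `q
  -- + 1`, so `q = -1` is recovered by continuity from the right.
  have hind : ∀ n : ℕ, ∀ q : ℝ, 1 - n < q → hankelRay d₁ q - hankelRay d₂ q =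
      2 * Real.pi * Complex.I * (Complex.Gamma (-q : ℝ))⁻¹ := by
    intro n
    induction n with
    | zero => simpa using hbase
    | succ n ih =>
      have hne : ∀ q : ℝ, 1 - (n + 1 : ℕ) < q → q ≠ -1 → hankelRay d₁ q - hankelRay d₂ q =
          2 * Real.pi * Complex.I * (Complex.Gamma (-q : ℝ))⁻¹ := by
        intro q hq hq1
        push_cast at hq
        have h := ih (q + 1) (by linarith)
        have a1 := hankelRay_add n1 r1 i1 (q + 1)
        have a2 := hankelRay_add n2 r2 i2 (q + 1)
        have hq0 : ((q : ℂ) + 1) ≠ 0 := by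
          intro h0
          apply hq1
          have : ((q + 1 : ℝ) : ℂ) = 0 := by push_cast; exact h0
          have := Complex.ofReal_eq_zero.1 this
          linarith
        have hg : Complex.Gamma (-q : ℝ) = -(q + 1) * Complex.Gamma (-(q + 1) : ℝ) := by
          have h0 : ((-(q + 1) : ℝ) : ℂ) ≠ 0 := by
            push_cast
            exact neg_ne_zero.2 hq0
          have := Complex.Gamma_add_one _ h0
          push_cast at this ⊢
          rw [← this]
          ring_nf
        rw [add_sub_cancel_right] at a1 a2
        rw [hg]
        push_cast at a1 a2 h ⊢
        apply mul_left_cancel₀ hq0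
        have : (q + 1 : ℂ) * (2 * Real.pi * Complex.I *
            (-(q + 1) * Complex.Gamma (-(q + 1)))⁻¹) =
            -(2 * Real.pi * Complex.I * (Complex.Gamma (-(q + 1)))⁻¹) := by
          rw [mul_inv]
          field_simp
        rw [this, ← h]
        linear_combination a1 - a2
      intro q hq
      rcases eq_or_ne q (-1) with rfl | hq1
      · refine tendsto_nhds_unique (f := fun q => hankelRay d₁ q - hankelRay d₂ q)
          (l := 𝓝[>] (-1)) ((hcontL.tendsto (-1)).mono_left nhdsWithin_le_nhds) ?_
        refine ((hcontR.tendsto (-1)).mono_left nhdsWithin_le_nhds).congr' ?_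
        filter_upwards [self_mem_nhdsWithin] with r hr
        exact (hne r (hq.trans hr) (ne_of_gt hr)).symm
      · exact hne q hq hq1
  obtain ⟨n, hn⟩ := exists_nat_gt (1 - p)
  exact hind n p (by linarith)

/-! ### Contour representation of the Mittag-Leffler function for `a < 1` -/

/-- An argument larger than `δ` would make `sin (arg s - δ)` positive, while `‖s‖ * sin (arg s - δ)
= -sin δ` is negative. -/
lemma abs_arg_one_add_mul_exp_le {δ x : ℝ} (h1 : 0 < δ) (h2 : δ < Real.pi) (hx : 0 ≤ x) :
    |Complex.arg (1 + x * Complex.exp (δ * Complex.I))| ≤ δ := by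
  set s := 1 + (x : ℂ) * Complex.exp (δ * Complex.I) with hs
  have hsin : 0 < Real.sin δ := Real.sin_pos_of_pos_of_lt_pi h1 h2
  have him : s.im = x * Real.sin δ := by
    simp [hs, Complex.exp_ofReal_mul_I_im]
  have hre : s.re = 1 + x * Real.cos δ := by
    simp [hs, Complex.exp_ofReal_mul_I_re]
  have h0 : 0 ≤ s.arg := Complex.arg_nonneg_iff.2 (by rw [him]; positivity)
  rw [abs_of_nonneg h0]
  by_contra! hlt
  have hpos : 0 < Real.sin (s.arg - δ) :=
    Real.sin_pos_of_pos_of_lt_pi (by linarith) (by linarith [Complex.arg_le_pi s])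
  have e1 := Complex.norm_mul_sin_arg s
  have e2 := Complex.norm_mul_cos_arg s
  have : ‖s‖ * Real.sin (s.arg - δ) = -Real.sin δ := by
    rw [Real.sin_sub, mul_sub, ← mul_assoc, ← mul_assoc, e1, e2, him, hre]
    ring
  nlinarith [norm_nonneg s]

lemma abs_arg_conj (s : ℂ) : |(starRingEnd ℂ s).arg| = |s.arg| := by
  rw [Complex.arg_conj]
  split_ifs with h
  · rw [h]
  · exact abs_neg _

lemma abs_arg_one_add_mul_exp_neg_le {δ x : ℝ} (h1 : 0 < δ) (h2 : δ < Real.pi) (hx : 0 ≤ x) :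
    |Complex.arg (1 + x * Complex.exp (-δ * Complex.I))| ≤ δ := by
  have : 1 + (x : ℂ) * Complex.exp (-δ * Complex.I) =
      starRingEnd ℂ (1 + x * Complex.exp (δ * Complex.I)) := by
    simp [← Complex.exp_conj]
  rw [this, abs_arg_conj]
  exact abs_arg_one_add_mul_exp_le h1 h2 hx

/-- When `a δ < π / 2`, this places the image of the contour under `s ↦ s ^ a` in a closed sector
inside the right half plane, away from every `w ≠ 0` with `Re w ≤ 0`. -/
lemma cos_mul_le_re_cpow {a δ : ℝ} (ha : 0 < a) (hδ : a * δ ≤ Real.pi) {s : ℂ}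
    (hs : |s.arg| ≤ δ) : Real.cos (a * δ) * ‖s‖ ^ a ≤ (s ^ (a : ℂ)).re := by
  rw [Complex.cpow_ofReal_re, mul_comm]
  gcongr
  rw [← Real.cos_abs (s.arg * a), abs_mul, abs_of_pos ha, mul_comm a δ]
  exact Real.cos_le_cos_of_nonneg_of_le_pi (by positivity) (by linarith) (by gcongr)

/-- The contribution of the ray from `1` in the direction `d` to the contour integral of
`e ^ s * s ^ (a - b) / (s ^ a - w)`. -/
noncomputable def resolventRay (a b : ℝ) (d w : ℂ) : ℂ :=
  ∫ x in Set.Ioi (0 : ℝ), Complex.exp (1 + x * d) * (1 + x * d) ^ ((a - b : ℝ) : ℂ) *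
    ((1 + x * d) ^ (a : ℂ) - w)⁻¹ * d

section ray
variable {d : ℂ} {a b σ : ℝ}

lemma mul_rpow_le_re_cpow (hd : ‖d‖ = 1) (ha : 0 < a) (hσ : 0 < σ)
    (h : ∀ x : ℝ, 0 ≤ x → σ * ‖1 + x * d‖ ^ a ≤ ((1 + x * d) ^ (a : ℂ)).re) {x : ℝ} (hx : 0 ≤ x) :
    σ * |d.im| ^ a ≤ ((1 + x * d) ^ (a : ℂ)).re := by
  refine le_trans ?_ (h x hx)
  gcongr
  exact abs_im_le_norm_one_add_mul hd x

lemma measurable_resolventRay_integrand (a p : ℝ) (d w : ℂ) :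
    Measurable fun x : ℝ => Complex.exp (1 + x * d) * (1 + x * d) ^ (p : ℂ) *
      ((1 + x * d) ^ (a : ℂ) - w)⁻¹ * d := by
  fun_prop

/-- On this half plane the denominator is locally bounded below, so differentiation under the
integral is allowed. The half plane contains both a neighbourhood of `0` and the closed left half
plane, which the identity theorem will link. -/
lemma differentiableOn_resolventRay (hd : ‖d‖ = 1) (hre : d.re < 0) (him : d.im ≠ 0)
    (ha : 0 < a) (hσ : 0 < σ)
    (h : ∀ x : ℝ, 0 ≤ x → σ * ‖1 + x * d‖ ^ a ≤ ((1 + x * d) ^ (a : ℂ)).re) :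
    DifferentiableOn ℂ (resolventRay a b d) {w | w.re < σ * |d.im| ^ a} := by
  intro w hw
  set c := σ * |d.im| ^ a with hc
  have hw : w.re < c := hw
  set ε := (c - w.re) / 2 with hε
  have hε0 : 0 < ε := by linarith
  have hK := integrableOn_cexp_mul_cpow hd hre him (a - b)
  have hlow : ∀ x : ℝ, 0 ≤ x → ∀ v : ℂ, v.re < w.re + ε → ε ≤ ‖(1 + x * d) ^ (a : ℂ) - v‖ := by
    intro x hx v hv
    have h1 := mul_rpow_le_re_cpow hd ha hσ h hx
    have h2 := Complex.re_le_norm ((1 + x * d) ^ (a : ℂ) - v)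
    rw [Complex.sub_re] at h2
    linarith
  have hs : {v : ℂ | v.re < w.re + ε} ∈ 𝓝 w :=
    (isOpen_lt Complex.continuous_re continuous_const).mem_nhds
      (show w.re < w.re + ε by linarith)
  have hmem : w.re < w.re + ε := by linarith
  refine (hasDerivAt_integral_of_dominated_loc_of_deriv_le (μ := volume.restrict (Set.Ioi (0 : ℝ)))
    (F := fun v x => Complex.exp (1 + x * d) * (1 + x * d) ^ ((a - b : ℝ) : ℂ) *
      ((1 + x * d) ^ (a : ℂ) - v)⁻¹ * d)
    (F' := fun v x => Complex.exp (1 + x * d) * (1 + x * d) ^ ((a - b : ℝ) : ℂ) *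
      (1 / ((1 + x * d) ^ (a : ℂ) - v) ^ 2) * d)
    (bound := fun x => ‖Complex.exp (1 + x * d) * (1 + x * d) ^ ((a - b : ℝ) : ℂ)‖ *
      (1 / ε ^ 2)) hs
    (Eventually.of_forall fun v =>
      (measurable_resolventRay_integrand a _ d v).aestronglyMeasurable) ?_
    ?_ ?_ (hK.norm.mul_const _)
    ?_).2.differentiableAt.differentiableWithinAt
  · refine (hK.norm.mul_const ε⁻¹).mono'
      (measurable_resolventRay_integrand a _ d w).aestronglyMeasurable ?_
    filter_upwards [ae_restrict_mem measurableSet_Ioi] with x hx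
    rw [norm_mul, hd, mul_one, norm_mul, norm_inv]
    gcongr
    exact hlow x (le_of_lt hx) w hmem
  · refine Measurable.aestronglyMeasurable ?_
    fun_prop
  · filter_upwards [ae_restrict_mem measurableSet_Ioi] with x hx v hv
    rw [norm_mul, hd, mul_one, norm_mul, norm_div, norm_one, norm_pow]
    gcongr
    exact hlow x (le_of_lt hx) v hv
  · filter_upwards [ae_restrict_mem measurableSet_Ioi] with x hx v hv
    have hne : (1 + x * d) ^ (a : ℂ) - v ≠ 0 :=
      norm_pos_iff.1 (hε0.trans_le (hlow x (le_of_lt hx) v hv))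
    have h1 : HasDerivAt (fun v => (1 + x * d) ^ (a : ℂ) - v) (-1) v :=
      (hasDerivAt_id v).const_sub _
    have h2 := h1.fun_inv hne
    rw [neg_neg] at h2
    exact (h2.const_mul _).mul_const d

/-- Write `s = 1 + x d` and `N = ‖s ^ a - w‖`. As `Re w ≤ 0`, the sector condition gives `σ ‖s‖ ^ a
≤ N`, hence `‖w‖ ≤ N + ‖s‖ ^ a ≤ (1 + 1 / σ) N`. -/
lemma exists_norm_resolventRay_le (hd : ‖d‖ = 1) (hre : d.re < 0) (him : d.im ≠ 0)
    (hσ : 0 < σ)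
    (h : ∀ x : ℝ, 0 ≤ x → σ * ‖1 + x * d‖ ^ a ≤ ((1 + x * d) ^ (a : ℂ)).re) :
    ∃ C : ℝ, 0 ≤ C ∧ ∀ w : ℂ, w.re ≤ 0 → w ≠ 0 → ‖resolventRay a b d w‖ ≤ C / ‖w‖ := by
  have hK := integrableOn_cexp_mul_cpow hd hre him (a - b)
  refine ⟨(∫ x in Set.Ioi (0 : ℝ),
    ‖Complex.exp (1 + x * d) * (1 + x * d) ^ ((a - b : ℝ) : ℂ)‖) * (1 + 1 / σ),
    by positivity, fun w hw hw0 => ?_⟩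
  have hw0' : 0 < ‖w‖ := norm_pos_iff.2 hw0
  rw [mul_div_assoc, ← integral_mul_const]
  refine norm_integral_le_of_norm_le (hK.norm.mul_const _) ?_
  filter_upwards [ae_restrict_mem measurableSet_Ioi] with x hx
  rw [norm_mul, hd, mul_one, norm_mul, norm_inv]
  gcongr
  have h1 := h x (le_of_lt hx)
  have h2 := Complex.re_le_norm ((1 + x * d) ^ (a : ℂ) - w)
  have h3 : ‖w‖ ≤ ‖(1 + x * d) ^ (a : ℂ) - w‖ + ‖1 + x * d‖ ^ a := by
    rw [← Complex.norm_cpow_real]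
    have := norm_sub_le ((1 + x * d) ^ (a : ℂ)) ((1 + x * d) ^ (a : ℂ) - w)
    rw [sub_sub_cancel] at this
    linarith
  rw [Complex.sub_re] at h2
  set N := ‖(1 + x * d) ^ (a : ℂ) - w‖
  have h4 : ‖1 + x * d‖ ^ a ≤ N / σ := by
    rw [le_div_iff₀ hσ]
    linarith
  have h5 : ‖w‖ ≤ (1 + 1 / σ) * N := by
    calc ‖w‖ ≤ N + N / σ := by linarith
      _ = _ := by ring
  have hN : 0 < N := by
    by_contra! hN
    have : (1 + 1 / σ) * N ≤ 0 := mul_nonpos_of_nonneg_of_nonpos (by positivity) hN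
    linarith
  rw [inv_eq_one_div, div_le_div_iff₀ hN hw0']
  linarith

/-- Expansion of `1 / (s ^ a - w)` as a geometric series in `w / s ^ a`, whose ratio is bounded
uniformly along the ray because `|d.im| ^ a ≤ ‖s ^ a‖`. -/
lemma hasSum_resolventRay (hd : ‖d‖ = 1) (hre : d.re < 0) (him : d.im ≠ 0) (ha : 0 < a)
    (b : ℝ) {w : ℂ} (hw : ‖w‖ < |d.im| ^ a) :
    HasSum (fun k : ℕ => w ^ k * hankelRay d (-(a * k + b))) (resolventRay a b d w) := by
  have h0 : 0 < |d.im| := abs_pos.2 him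
  have hη : 0 < |d.im| ^ a := by positivity
  have hne : ∀ x : ℝ, (1 : ℂ) + x * d ≠ 0 := fun x => by
    have := add_mul_mem_slitPlane him (a := 1) (x := x) (Or.inl one_pos)
    simpa using Complex.slitPlane_ne_zero this
  have hpow : ∀ x : ℝ, |d.im| ^ a ≤ ‖(1 + x * d) ^ (a : ℂ)‖ := fun x => by
    rw [Complex.norm_cpow_real]
    gcongr
    exact abs_im_le_norm_one_add_mul hd x
  have hsplit : ∀ (k : ℕ) (x : ℝ), (1 + x * d) ^ ((-(a * k + b) : ℝ) : ℂ) =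
      ((1 + x * d) ^ (a : ℂ))⁻¹ ^ k * (1 + x * d) ^ ((-b : ℝ) : ℂ) := by
    intro k x
    have : ((-(a * k + b) : ℝ) : ℂ) = -((k : ℂ) * a) + ((-b : ℝ) : ℂ) := by push_cast; ring
    rw [this, Complex.cpow_add _ _ (hne x), Complex.cpow_neg, Complex.cpow_nat_mul, inv_pow]
  set K : ℝ → ℂ := fun x => Complex.exp (1 + x * d) * (1 + x * d) ^ ((-b : ℝ) : ℂ) with hKdef
  have hK : IntegrableOn K (Set.Ioi 0) := integrableOn_cexp_mul_cpow hd hre him (-b)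
  set F : ℕ → ℝ → ℂ := fun k x => w ^ k * (Complex.exp (1 + x * d) *
    (1 + x * d) ^ ((-(a * k + b) : ℝ) : ℂ) * d) with hF
  have hFK : ∀ k x, F k x = (w * ((1 + x * d) ^ (a : ℂ))⁻¹) ^ k * (K x * d) := by
    intro k x
    simp only [hF, hKdef, hsplit, mul_pow]
    ring
  have hFint : ∀ k, Integrable (F k) (volume.restrict (Set.Ioi 0)) := fun k =>
    ((integrableOn_cexp_mul_cpow hd hre him _).mul_const d).const_mul _
  set q := ‖w‖ / |d.im| ^ a with hq
  have hq1 : q < 1 := (div_lt_one hη).2 hw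
  have hratio : ∀ x : ℝ, ‖w * ((1 + x * d) ^ (a : ℂ))⁻¹‖ ≤ q := by
    intro x
    rw [norm_mul, norm_inv, hq, div_eq_mul_inv]
    gcongr
    exact hpow x
  have hsum : Summable fun k => ∫ x in Set.Ioi (0 : ℝ), ‖F k x‖ := by
    refine Summable.of_nonneg_of_le (fun k => by positivity) (fun k => ?_)
      ((summable_geometric_of_lt_one (by positivity) hq1).mul_right
        (∫ x in Set.Ioi (0 : ℝ), ‖K x‖))
    rw [← integral_const_mul]
    refine integral_mono (hFint k).norm (hK.norm.const_mul _) fun x => ?_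
    simp only [hFK, norm_mul, norm_pow, hd, mul_one]
    rw [← norm_mul]
    gcongr
    exact hratio x
  have hmain := hasSum_integral_of_summable_integral_norm hFint hsum
  have e1 : ∀ k, ∫ x in Set.Ioi (0 : ℝ), F k x = w ^ k * hankelRay d (-(a * k + b)) :=
    fun k => integral_const_mul _ _
  have e2 : ∫ x in Set.Ioi (0 : ℝ), ∑' k, F k x = resolventRay a b d w := by
    refine integral_congr_ae (Eventually.of_forall fun x => ?_)
    simp only [hFK]
    rw [tsum_mul_right, tsum_geometric_of_norm_lt_one ((hratio x).trans_lt hq1)]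
    have hs0 : (1 + x * d) ^ (a : ℂ) ≠ 0 := norm_pos_iff.1 (hη.trans_le (hpow x))
    have : ((a - b : ℝ) : ℂ) = a + ((-b : ℝ) : ℂ) := by push_cast; ring
    rw [this, Complex.cpow_add _ _ (hne x)]
    have h1 : 1 - w * ((1 + x * d) ^ (a : ℂ))⁻¹ =
        ((1 + x * d) ^ (a : ℂ) - w) * ((1 + x * d) ^ (a : ℂ))⁻¹ := by
      rw [sub_mul, mul_inv_cancel₀ hs0]
    rw [h1, mul_inv, inv_inv]
    ring
  rw [e2] at hmain
  simpa only [e1] using hmain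

end ray

/-- For `0 < a < 1` the Mittag-Leffler function decays like `1 / |w|` on the closed left half
plane. -/
theorem exists_norm_mittagLeffler_le_of_lt_one {a : ℝ} (ha : 1 / 2 < a) (ha1 : a < 1) (b : ℝ) :
    ∃ C : ℝ, 0 < C ∧ ∀ w : ℂ, w.re ≤ 0 → ‖mittagLeffler a b w‖ ≤ C / (1 + ‖w‖) := by
  have hπ := Real.pi_pos
  have ha0 : 0 < a := by linarith
  -- `δ > π / 2` makes `e ^ s` decay and `a δ < π / 2` keeps `s ^ a` in the right half plane; such a
  -- `δ` exists exactly because `a < 1`. The bound `1 / 2 < a` ensures `δ < π`.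
  obtain ⟨δ, h1, h2⟩ : ∃ δ, Real.pi / 2 < δ ∧ δ < Real.pi / (2 * a) :=
    exists_between (by gcongr; linarith)
  have haδ : a * δ < Real.pi / 2 := by
    rw [lt_div_iff₀ (by positivity)] at h2
    linarith
  have hδπ : δ < Real.pi := h2.trans (div_lt_self hπ (by linarith))
  have hδ0 : 0 < δ := by linarith
  set d₁ := Complex.exp (δ * Complex.I) with hd₁
  set d₂ := Complex.exp (-δ * Complex.I) with hd₂
  have n1 : ‖d₁‖ = 1 := Complex.norm_exp_ofReal_mul_I δ
  have n2 : ‖d₂‖ = 1 := by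
    have := Complex.norm_exp_ofReal_mul_I (-δ)
    rwa [Complex.ofReal_neg] at this
  have hcos : Real.cos δ < 0 := Real.cos_neg_of_pi_div_two_lt_of_lt h1 (by linarith)
  have hsin : 0 < Real.sin δ := Real.sin_pos_of_pos_of_lt_pi hδ0 hδπ
  have r1 : d₁.re < 0 := by rw [hd₁, Complex.exp_ofReal_mul_I_re]; exact hcos
  have im1 : d₁.im = Real.sin δ := by rw [hd₁, Complex.exp_ofReal_mul_I_im]
  have r2 : d₂.re < 0 := by
    rw [hd₂, ← Complex.ofReal_neg, Complex.exp_ofReal_mul_I_re, Real.cos_neg]; exact hcos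
  have im2 : d₂.im = -Real.sin δ := by
    rw [hd₂, ← Complex.ofReal_neg, Complex.exp_ofReal_mul_I_im, Real.sin_neg]
  have i1 : d₁.im ≠ 0 := by rw [im1]; exact hsin.ne'
  have i2 : d₂.im ≠ 0 := by rw [im2]; exact (neg_neg_of_pos hsin).ne
  have hη : |d₂.im| = |d₁.im| := by rw [im1, im2, abs_neg]
  have hη0 : 0 < |d₁.im| ^ a := Real.rpow_pos_of_pos (abs_pos.2 i1) a
  set σ := Real.cos (a * δ)
  have hσ : 0 < σ := Real.cos_pos_of_mem_Ioo ⟨by nlinarith, haδ⟩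
  have s1 : ∀ x : ℝ, 0 ≤ x → σ * ‖1 + x * d₁‖ ^ a ≤ ((1 + x * d₁) ^ (a : ℂ)).re := fun x hx =>
    cos_mul_le_re_cpow ha0 (by linarith) (abs_arg_one_add_mul_exp_le hδ0 hδπ hx)
  have s2 : ∀ x : ℝ, 0 ≤ x → σ * ‖1 + x * d₂‖ ^ a ≤ ((1 + x * d₂) ^ (a : ℂ)).re := fun x hx =>
    cos_mul_le_re_cpow ha0 (by linarith) (abs_arg_one_add_mul_exp_neg_le hδ0 hδπ hx)
  -- Near `0` both sides have the same power series, by Hankel's formula applied to each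
  -- coefficient; analyticity extends the equality to the half plane.
  have hrep : ∀ w : ℂ, w.re ≤ 0 → 2 * Real.pi * Complex.I * mittagLeffler a b w =
      resolventRay a b d₁ w - resolventRay a b d₂ w := by
    intro w hw
    have hU : IsOpen {w : ℂ | w.re < σ * |d₁.im| ^ a} :=
      isOpen_lt Complex.continuous_re continuous_const
    have hconv : IsPreconnected {w : ℂ | w.re < σ * |d₁.im| ^ a} :=
      (convex_halfSpace_re_lt _).isPreconnected
    have hL : AnalyticOnNhd ℂ (fun w => 2 * Real.pi * Complex.I * mittagLeffler a b w)
        {w : ℂ | w.re < σ * |d₁.im| ^ a} :=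
      ((differentiable_mittagLeffler ha0 b).const_mul _).differentiableOn.analyticOnNhd hU
    have D1 := differentiableOn_resolventRay (b := b) n1 r1 i1 ha0 hσ s1
    have D2 := differentiableOn_resolventRay (b := b) n2 r2 i2 ha0 hσ s2
    rw [hη] at D2
    have hR := (D1.fun_sub D2).analyticOnNhd hU
    refine hL.eqOn_of_preconnected_of_eventuallyEq hR hconv (z₀ := 0) ?_ ?_ ?_
    · simpa using mul_pos hσ hη0
    · have : ∀ᶠ v : ℂ in 𝓝 0, ‖v‖ < |d₁.im| ^ a := by
        filter_upwards [Metric.ball_mem_nhds (0 : ℂ) hη0] with v hv using by simpa using hv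
      filter_upwards [this] with v hv
      have t1 := hasSum_resolventRay n1 r1 i1 ha0 b hv
      have t2 := hasSum_resolventRay n2 r2 i2 ha0 b (hη.symm ▸ hv)
      have t3 := ((summable_mittagLeffler ha0 b v).hasSum).mul_left (2 * Real.pi * Complex.I)
      rw [← mittagLeffler_eq_tsum] at t3
      refine t3.unique ((t1.sub t2).congr_fun fun k => ?_)
      rw [← mul_sub, hankelRay_sub_hankelRay h1 hδπ, neg_neg, mlCoeff]
      ring
    · exact lt_of_le_of_lt hw (mul_pos hσ hη0)
  obtain ⟨C₀, hC₀, hsmall⟩ := exists_norm_mittagLeffler_le_of_norm_le_one ha0 b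
  obtain ⟨C₁, hC₁, hl1⟩ := exists_norm_resolventRay_le (b := b) n1 r1 i1 hσ s1
  obtain ⟨C₂, hC₂, hl2⟩ := exists_norm_resolventRay_le (b := b) n2 r2 i2 hσ s2
  refine ⟨C₀ + 2 * (C₁ + C₂), by positivity, fun w hw => ?_⟩
  have hden : 0 < 1 + ‖w‖ := by positivity
  rcases le_total ‖w‖ 1 with hle | hge
  · refine (hsmall w hle).trans ?_
    gcongr
    linarith
  · have hw0 : w ≠ 0 := norm_pos_iff.1 (by linarith)
    have hn : ‖2 * Real.pi * Complex.I * mittagLeffler a b w‖ ≤ C₁ / ‖w‖ + C₂ / ‖w‖ := by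
      rw [hrep w hw]
      exact (norm_sub_le _ _).trans (add_le_add (hl1 w hw hw0) (hl2 w hw hw0))
    have hn2 : ‖2 * Real.pi * Complex.I * mittagLeffler a b w‖ =
        2 * Real.pi * ‖mittagLeffler a b w‖ := by
      simp [abs_of_pos hπ]
    have hπ1 : 1 ≤ 2 * Real.pi := by linarith [Real.pi_gt_three]
    have hn3 : ‖mittagLeffler a b w‖ ≤ (C₁ + C₂) / ‖w‖ := by
      rw [add_div]
      refine le_trans (le_mul_of_one_le_left (norm_nonneg _) hπ1) (hn2 ▸ hn)
    refine hn3.trans ?_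
    rw [div_le_div_iff₀ (by linarith) hden]
    nlinarith [mul_nonneg hC₀.le (norm_nonneg w)]

/-! ### The case `a = 1` -/

lemma mittagLeffler_one_sub_one (b : ℝ) (w : ℂ) :
    mittagLeffler 1 (b - 1) w = mlCoeff 1 (b - 1) 0 + w * mittagLeffler 1 b w := by
  rw [mittagLeffler_eq_tsum, mittagLeffler_eq_tsum,
    (summable_mittagLeffler one_pos (b - 1) w).tsum_eq_zero_add, ← tsum_mul_left]
  congr 1
  · simp
  · refine tsum_congr fun r => ?_
    have : mlCoeff 1 (b - 1) (r + 1) = mlCoeff 1 b r := by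
      simp only [mlCoeff]
      push_cast
      ring_nf
    rw [this]
    ring

lemma add_mul_mlCoeff_one (b : ℝ) (r : ℕ) :
    ((r : ℂ) + (b - 1)) * mlCoeff 1 b r = mlCoeff 1 (b - 1) r := by
  have h := Complex.one_div_Gamma_eq_self_mul_one_div_Gamma_add_one ((r : ℂ) + (b - 1))
  simp only [mlCoeff]
  push_cast
  rw [one_mul, h]
  ring_nf

/-- The differential equation of the Mittag-Leffler function with first parameter `1`. -/
lemma mul_deriv_mittagLeffler_one (b : ℝ) (w : ℂ) :
    w * deriv (mittagLeffler 1 b) w =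
      (1 - b + w) * mittagLeffler 1 b w + mlCoeff 1 (b - 1) 0 := by
  have h1 := hasSum_deriv_mittagLeffler one_pos b w
  have h2 := ((summable_mittagLeffler one_pos b w).hasSum).mul_left ((b : ℂ) - 1)
  have h3 := (summable_mittagLeffler one_pos (b - 1) w).hasSum
  rw [← mittagLeffler_eq_tsum] at h2 h3
  have h4 := h3.unique ((h1.add h2).congr_fun fun r => by
    rw [← add_mul_mlCoeff_one]
    ring)
  rw [mittagLeffler_one_sub_one] at h4
  linear_combination -h4

/-- The hypothesis on `g` says that its argument is at most `3π/4` in absolute value, so the ray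
from `1` in direction `g` misses the negative axis. -/
lemma one_add_mul_mem_slitPlane {g : ℂ} (hg : -‖g‖ ≤ Real.sqrt 2 * g.re) {x : ℝ} (hx : 0 ≤ x) :
    1 + (x : ℂ) * g ∈ Complex.slitPlane := by
  by_contra hcon
  rw [Complex.mem_slitPlane_iff, not_or, not_lt, not_not] at hcon
  have hre : 1 + x * g.re ≤ 0 := by simpa using hcon.1
  have him : x * g.im = 0 := by simpa using hcon.2
  have hx0 : x ≠ 0 := by
    rintro rfl
    norm_num at hre
  have hgi : g.im = 0 := (mul_eq_zero.1 him).resolve_left hx0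
  have hgr : g.re < 0 := by
    by_contra! h
    nlinarith
  have hn : ‖g‖ = -g.re := by
    rw [← abs_of_neg hgr]
    exact (Complex.abs_re_eq_norm.2 hgi).symm
  have h2 : 1 < Real.sqrt 2 := Real.one_lt_sqrt_two
  nlinarith

lemma half_le_norm_one_add_mul {g : ℂ} (hg : -‖g‖ ≤ Real.sqrt 2 * g.re) {x : ℝ} (hx : 0 ≤ x) :
    1 / 2 ≤ ‖1 + (x : ℂ) * g‖ := by
  have h : ‖1 + (x : ℂ) * g‖ ^ 2 = 1 + 2 * (x * g.re) + (x * ‖g‖) ^ 2 := by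
    rw [mul_pow, ← Complex.normSq_eq_norm_sq, ← Complex.normSq_eq_norm_sq, Complex.normSq_apply,
      Complex.normSq_apply]
    simp
    ring
  have h2 : Real.sqrt 2 ^ 2 = 2 := Real.sq_sqrt (by norm_num)
  have h3 : 0 < Real.sqrt 2 := by positivity
  have h4 : -(Real.sqrt 2 * (x * ‖g‖)) ≤ 2 * (x * g.re) := by
    have := mul_le_mul_of_nonneg_left hg (mul_nonneg h3.le hx)
    nlinarith
  refine le_of_sq_le_sq ?_ (norm_nonneg _)
  rw [h]
  -- With `u = x * ‖g‖` the squared norm is at least `1 - √2 u + u ^ 2 = (u - √2 / 2) ^ 2 + 1 / 2`.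
  nlinarith [sq_nonneg (x * ‖g‖ - Real.sqrt 2 / 2)]

lemma rpow_le_two_rpow_mul_rpow {r T : ℝ} (p : ℝ) (hr : 1 / 2 ≤ r) (hrT : r ≤ T) (hT : 1 ≤ T) :
    r ^ p ≤ 2 ^ |p| * T ^ |p| := by
  have hr0 : 0 < r := by linarith
  rcases le_total 0 p with h | h
  · rw [abs_of_nonneg h]
    exact (Real.rpow_le_rpow hr0.le hrT h).trans
      (le_mul_of_one_le_left (by positivity) (Real.one_le_rpow one_le_two h))
  · rw [abs_of_nonpos h]
    calc r ^ p ≤ (1 / 2) ^ p := Real.rpow_le_rpow_of_nonpos (by norm_num) hr h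
      _ = 2 ^ (-p) := by rw [one_div, Real.inv_rpow zero_le_two, Real.rpow_neg zero_le_two]
      _ ≤ _ := le_mul_of_one_le_right (by positivity) (Real.one_le_rpow hT (by linarith))

/-- The function is `E` times the integrating factor `e ^ (-s) * s ^ (b - 1)` of the differential
equation at `s = w + x v`, normalised to `1` at `x = 0`. Only the inhomogeneous term survives.
Taking the power of `s / w` instead of `s` keeps it on the principal branch. -/
lemma hasDerivAt_exp_mul_cpow_mul_mittagLeffler_one (b : ℝ) {w v : ℂ} (hw : w ≠ 0) {x : ℝ}
    (hs : 1 + (x : ℂ) * (v / w) ∈ Complex.slitPlane) :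
    HasDerivAt (fun x : ℝ => Complex.exp (-(x * v)) * (1 + x * (v / w)) ^ ((b - 1 : ℝ) : ℂ) *
        mittagLeffler 1 b (w + x * v))
      (v / w * mlCoeff 1 (b - 1) 0 *
        (Complex.exp (-(x * v)) * (1 + x * (v / w)) ^ ((b - 2 : ℝ) : ℂ))) x := by
  have hid : HasDerivAt (fun x : ℝ => (x : ℂ)) 1 x := Complex.ofRealCLM.hasDerivAt
  have h1 : HasDerivAt (fun x : ℝ => Complex.exp (-(x * v)))
      (Complex.exp (-(x * v)) * (-(1 * v))) x := (hid.mul_const v).fun_neg.cexp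
  have h2 : HasDerivAt (fun x : ℝ => 1 + (x : ℂ) * (v / w)) (1 * (v / w)) x :=
    (hid.mul_const (v / w)).const_add 1
  have h3 := ((hasDerivAt_id _).cpow_const (c := ((b - 1 : ℝ) : ℂ)) hs).comp x h2
  have h4 : HasDerivAt (fun x : ℝ => w + (x : ℂ) * v) (1 * v) x := (hid.mul_const v).const_add w
  have h5 := ((differentiable_mittagLeffler one_pos b (w + x * v)).hasDerivAt).comp x h4
  have h6 := (h1.mul h3).mul h5
  convert! h6 using 1
  have hode := mul_deriv_mittagLeffler_one b (w + x * v)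
  have hpow : (1 + (x : ℂ) * (v / w)) ^ ((b - 1 : ℝ) : ℂ) =
      (1 + (x : ℂ) * (v / w)) ^ ((b - 2 : ℝ) : ℂ) * (1 + (x : ℂ) * (v / w)) := by
    have : ((b - 1 : ℝ) : ℂ) = ((b - 2 : ℝ) : ℂ) + 1 := by push_cast; ring
    rw [this, Complex.cpow_add _ _ (Complex.slitPlane_ne_zero hs), Complex.cpow_one]
  have hsub : ((b - 1 : ℝ) : ℂ) - 1 = ((b - 2 : ℝ) : ℂ) := by push_cast; ring
  have hfac : w + (x : ℂ) * v = w * (1 + x * (v / w)) := by field_simp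
  simp only [Function.comp, Pi.mul_apply, id, hsub, hpow, mul_one, one_mul]
  set P := (1 + (x : ℂ) * (v / w)) ^ ((b - 2 : ℝ) : ℂ)
  set Ex := Complex.exp (-(x * v))
  set M := mittagLeffler 1 b (w + x * v)
  set M' := deriv (mittagLeffler 1 b) (w + x * v)
  have hgoal : (1 + (x : ℂ) * (v / w)) * v = v / w * (w + x * v) := by field_simp
  push_cast
  linear_combination (v / w * Ex * P) * (-hode) + Ex * P * (M - M') * hgoal

/-- Comparison of the Mittag-Leffler function with first parameter `1` at two points whose
segment avoids the origin. -/
lemma exists_norm_exp_mul_mittagLeffler_one_sub_le (b : ℝ) :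
    ∃ D : ℝ, 0 ≤ D ∧ ∀ w v : ℂ, 1 ≤ ‖w‖ → v.re = 1 → ‖v‖ ≤ 2 →
      -‖v / w‖ ≤ Real.sqrt 2 * (v / w).re → ∀ X : ℝ, 0 ≤ X →
      ‖Complex.exp (-(X * v)) * (1 + X * (v / w)) ^ ((b - 1 : ℝ) : ℂ) *
        mittagLeffler 1 b (w + X * v) - mittagLeffler 1 b w‖ ≤ D / ‖w‖ := by
  set B := |b - 2|
  set c := mlCoeff 1 (b - 1) 0
  -- The condition `v.re = 1` gives `e ^ (-x v)` modulus `e ^ (-x)`, so the integral over `(0, ∞)`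
  -- bounds every segment, whatever `X`. The factor `v / w` of the derivative supplies the `1 /
  -- ‖w‖`.
  have hint := (integrableOn_one_add_rpow_mul_exp_neg_mul B one_pos).const_mul
    (2 * ‖c‖ * (2 ^ B * 2 ^ B))
  refine ⟨∫ x in Set.Ioi (0 : ℝ),
    2 * ‖c‖ * (2 ^ B * 2 ^ B) * ((1 + x) ^ B * Real.exp (-1 * x)), ?_, ?_⟩
  · refine setIntegral_nonneg measurableSet_Ioi fun x hx => ?_
    have : (0 : ℝ) < x := hx
    positivity
  intro w v hw hv hv2 hg X hX
  have hw0 : w ≠ 0 := norm_pos_iff.1 (by linarith)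
  have hgn : ‖v / w‖ ≤ 2 := by
    rw [norm_div]
    exact (div_le_self (norm_nonneg _) hw).trans hv2
  have hder : ∀ x ∈ Set.uIcc 0 X, HasDerivAt _ _ x := fun x hx =>
    hasDerivAt_exp_mul_cpow_mul_mittagLeffler_one b (v := v) (x := x) hw0
      (one_add_mul_mem_slitPlane hg (by rw [Set.uIcc_of_le hX] at hx; exact hx.1))
  have hcont : ContinuousOn (fun x : ℝ => v / w * c *
      (Complex.exp (-(x * v)) * (1 + x * (v / w)) ^ ((b - 2 : ℝ) : ℂ))) (Set.uIcc 0 X) := by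
    refine ContinuousOn.mul continuousOn_const (ContinuousOn.mul (by fun_prop) ?_)
    refine ContinuousOn.cpow_const (by fun_prop) fun x hx => ?_
    rw [Set.uIcc_of_le hX] at hx
    exact one_add_mul_mem_slitPlane hg hx.1
  have hftc := intervalIntegral.integral_eq_sub_of_hasDerivAt hder hcont.intervalIntegrable
  simp only [Complex.ofReal_zero, zero_mul, neg_zero, Complex.exp_zero, add_zero,
    Complex.one_cpow, one_mul] at hftc
  rw [← hftc, intervalIntegral.integral_of_le hX, ← integral_div]
  have hnonneg : ∀ x ∈ Set.Ioi (0 : ℝ),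
      0 ≤ 2 * ‖c‖ * (2 ^ B * 2 ^ B) * ((1 + x) ^ B * Real.exp (-1 * x)) / ‖w‖ := by
    intro x hx
    have : (0 : ℝ) < x := hx
    positivity
  refine (norm_integral_le_of_norm_le
    (IntegrableOn.mono_set (s := Set.Ioc 0 X) (hint.div_const ‖w‖) fun x hx => hx.1) ?_).trans
    (setIntegral_mono_set (hint.div_const ‖w‖) ?_ (Eventually.of_forall fun x hx => hx.1))
  · filter_upwards [ae_restrict_mem measurableSet_Ioc] with x hx
    have hx0 : 0 ≤ x := hx.1.le
    have e1 : ‖Complex.exp (-(x * v))‖ = Real.exp (-1 * x) := by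
      rw [Complex.norm_exp]
      simp [hv]
    have e2 : ‖1 + (x : ℂ) * (v / w)‖ ≤ 2 * (1 + x) := by
      refine (norm_add_le _ _).trans ?_
      rw [norm_one, norm_mul, Complex.norm_real, Real.norm_of_nonneg hx0]
      nlinarith
    have e3 := rpow_le_two_rpow_mul_rpow (b - 2) (half_le_norm_one_add_mul hg hx0) e2
      (by linarith)
    rw [Real.mul_rpow zero_le_two (by linarith)] at e3
    rw [norm_mul, norm_mul, norm_mul, e1, Complex.norm_cpow_real, norm_div]
    calc _ ≤ 2 / ‖w‖ * ‖c‖ * (Real.exp (-1 * x) * (2 ^ B * (2 ^ B * (1 + x) ^ B))) := by gcongr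
      _ = _ := by ring
  · filter_upwards [ae_restrict_mem measurableSet_Ioi] with x hx using hnonneg x hx

lemma norm_exp_mul_cpow_mul (b : ℝ) {w v : ℂ} (hw : w ≠ 0) (hv : v.re = 1) (X : ℝ) (E : ℂ) :
    ‖Complex.exp (-(X * v)) * (1 + X * (v / w)) ^ ((b - 1 : ℝ) : ℂ) * E‖ =
      Real.exp (-X) * (‖w + X * v‖ / ‖w‖) ^ (b - 1) * ‖E‖ := by
  have h : 1 + (X : ℂ) * (v / w) = (w + X * v) / w := by field_simp
  rw [norm_mul, norm_mul, Complex.norm_cpow_real, h, norm_div, Complex.norm_exp]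
  simp [hv]

/-- Comparison of `y` with the fixed point `1` along the real axis. -/
lemma exists_norm_mittagLeffler_one_ofReal_le (b : ℝ) :
    ∃ M : ℝ, 0 ≤ M ∧ ∀ y : ℝ, 1 ≤ y →
      Real.exp (-y) * ‖mittagLeffler 1 b y‖ ≤ M * y ^ (1 - b) := by
  obtain ⟨D, hD, h⟩ := exists_norm_exp_mul_mittagLeffler_one_sub_le b
  refine ⟨Real.exp (-1) * (D + ‖mittagLeffler 1 b 1‖), by positivity, fun y hy => ?_⟩
  have hy0 : 0 < y := by linarith
  have h1 := h 1 1 (by simp) (by simp) (by simp)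
    (by simpa using (by linarith [Real.sqrt_nonneg 2] : -1 ≤ Real.sqrt 2)) (y - 1) (by linarith)
  have h2 := (norm_le_norm_sub_add _ _).trans (add_le_add_left h1 ‖mittagLeffler 1 b 1‖)
  rw [norm_exp_mul_cpow_mul b one_ne_zero (by simp)] at h2
  have e : (1 : ℂ) + ((y - 1 : ℝ) : ℂ) * 1 = y := by push_cast; ring
  rw [e, norm_one, div_one, div_one, Complex.norm_real, Real.norm_of_nonneg hy0.le] at h2
  have hp : y ^ (1 - b) * y ^ (b - 1) = 1 := by
    rw [← Real.rpow_add hy0]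
    simp
  have hexp : Real.exp (-y) = Real.exp (-1) * Real.exp (-(y - 1)) := by
    rw [← Real.exp_add]
    ring_nf
  calc Real.exp (-y) * ‖mittagLeffler 1 b y‖
      = Real.exp (-1) * y ^ (1 - b) *
        (Real.exp (-(y - 1)) * y ^ (b - 1) * ‖mittagLeffler 1 b y‖) := by
        rw [hexp]
        linear_combination (-(Real.exp (-1) * Real.exp (-(y - 1)) * ‖mittagLeffler 1 b y‖)) * hp
    _ ≤ Real.exp (-1) * y ^ (1 - b) * (D + ‖mittagLeffler 1 b 1‖) := by gcongr
    _ = _ := by ring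

/-- Comparison of `i y` with `y` along the direction `1 - i`, the extreme case of the angle
condition. Both ends have modulus `y`, so the power in the integrating factor is `1` and its
exponential cancels the growth at `y`. -/
lemma exists_norm_mittagLeffler_one_mul_I_le (b : ℝ) :
    ∃ M : ℝ, 0 ≤ M ∧ ∀ y : ℝ, 1 ≤ y →
      ‖mittagLeffler 1 b (y * Complex.I)‖ ≤ M * y ^ (1 - b) + M / y := by
  obtain ⟨D, hD, h⟩ := exists_norm_exp_mul_mittagLeffler_one_sub_le b
  obtain ⟨M, hM, hreal⟩ := exists_norm_mittagLeffler_one_ofReal_le b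
  refine ⟨M + D, by positivity, fun y hy => ?_⟩
  have hy0 : 0 < y := by linarith
  have hyc : (y : ℂ) ≠ 0 := by exact_mod_cast hy0.ne'
  have hw : ‖(y : ℂ) * Complex.I‖ = y := by simp [abs_of_pos hy0]
  have hg : (1 - Complex.I) / (y * Complex.I) = -((y⁻¹ : ℝ) : ℂ) * (1 + Complex.I) := by
    push_cast
    field_simp
    linear_combination Complex.I_sq
  have hnorm : ‖(1 : ℂ) + Complex.I‖ = Real.sqrt 2 := by
    rw [Complex.norm_def, Complex.normSq_apply]
    norm_num
  have hnorm' : ‖(1 : ℂ) - Complex.I‖ = Real.sqrt 2 := by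
    rw [Complex.norm_def, Complex.normSq_apply]
    norm_num
  have hs2 : Real.sqrt 2 ≤ 2 := by
    rw [Real.sqrt_le_left (by norm_num)]
    norm_num
  have h1 := h (y * Complex.I) (1 - Complex.I) (by rw [hw]; exact hy) (by simp)
    (hnorm' ▸ hs2) (by
      rw [hg, norm_mul, hnorm, norm_neg, Complex.norm_real, Real.norm_of_nonneg (by positivity)]
      simp
      linarith) y hy0.le
  rw [norm_sub_rev] at h1
  have h2 := (norm_le_norm_sub_add _ _).trans (add_le_add_left h1 _)
  rw [norm_exp_mul_cpow_mul b (mul_ne_zero hyc Complex.I_ne_zero) (by simp)] at h2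
  have e : (y : ℂ) * Complex.I + y * (1 - Complex.I) = y := by ring
  rw [e, hw, Complex.norm_real, Real.norm_of_nonneg hy0.le, div_self hy0.ne', Real.one_rpow,
    mul_one] at h2
  have h3 := hreal y hy
  have h4 : 0 ≤ D * y ^ (1 - b) := by positivity
  have h5 : 0 ≤ M / y := by positivity
  rw [add_mul, add_div]
  linarith

/-- Comparison of `w` with a point `i y` of the imaginary axis along the direction `1 + i`. The
diagonal path stays away from `0` even for `w` on the negative real axis, and `‖w‖ ≤ y ≤ 2 ‖w‖`. -/
lemma exists_norm_mittagLeffler_one_le_of_one_le_norm (b : ℝ) :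
    ∃ C : ℝ, 0 ≤ C ∧ ∀ w : ℂ, w.re ≤ 0 → 0 ≤ w.im → 1 ≤ ‖w‖ →
      ‖mittagLeffler 1 b w‖ ≤ C * ‖w‖ ^ (1 - b) * Real.exp w.re + C / ‖w‖ := by
  obtain ⟨D, hD, h⟩ := exists_norm_exp_mul_mittagLeffler_one_sub_le b
  obtain ⟨M, hM, himag⟩ := exists_norm_mittagLeffler_one_mul_I_le b
  refine ⟨M + (D + 2 ^ |b - 1| * 2 ^ |b - 1| * M), by positivity, fun w hre him hw1 => ?_⟩
  have hw0' : 0 < ‖w‖ := by linarith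
  have hw0 : w ≠ 0 := norm_pos_iff.1 hw0'
  set y := w.im - w.re with hy
  have hyle : y ≤ 2 * ‖w‖ := by
    linarith [Complex.abs_re_le_norm w, Complex.abs_im_le_norm w, neg_abs_le w.re,
      le_abs_self w.im]
  have hwy : ‖w‖ ≤ y := by
    have := Complex.norm_le_abs_re_add_abs_im w
    rw [abs_of_nonpos hre, abs_of_nonneg him] at this
    linarith
  have hy0 : 0 < y := by linarith
  have hnorm : ‖(1 : ℂ) + Complex.I‖ = Real.sqrt 2 := by
    rw [Complex.norm_def, Complex.normSq_apply]
    norm_num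
  have hs2 : Real.sqrt 2 ≤ 2 := by
    rw [Real.sqrt_le_left (by norm_num)]
    norm_num
  have hg : ((1 + Complex.I) / w).re = (w.re + w.im) / ‖w‖ ^ 2 := by
    rw [Complex.div_re, Complex.normSq_eq_norm_sq]
    simp
    ring
  have h1 := h w (1 + Complex.I) hw1 (by simp) (hnorm ▸ hs2) (by
      rw [hg, norm_div, hnorm, ← mul_div_assoc, neg_le_iff_add_nonneg,
        div_add_div _ _ (by positivity) (by positivity)]
      have h0 : 0 ≤ w.re + w.im + ‖w‖ := by
        linarith [Complex.abs_re_le_norm w, neg_abs_le w.re]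
      have : Real.sqrt 2 * (w.re + w.im) * ‖w‖ + ‖w‖ ^ 2 * Real.sqrt 2 =
        Real.sqrt 2 * ‖w‖ * (w.re + w.im + ‖w‖) := by ring
      rw [this]
      positivity) (-w.re) (by linarith)
  rw [norm_sub_rev] at h1
  have h2 := (norm_le_norm_sub_add _ _).trans (add_le_add_left h1 _)
  rw [norm_exp_mul_cpow_mul b hw0 (by simp)] at h2
  have e : w + ((-w.re : ℝ) : ℂ) * (1 + Complex.I) = y * Complex.I := by
    apply Complex.ext <;> simp [hy]
    ring
  have ey : ‖(y : ℂ) * Complex.I‖ = y := by simp [abs_of_pos hy0]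
  rw [e, ey, neg_neg] at h2
  have h3 := himag y (hw1.trans hwy)
  have hexp1 : Real.exp w.re ≤ 1 := Real.exp_le_one_iff.2 hre
  have hratio : (y / ‖w‖) ^ (b - 1) ≤ 2 ^ |b - 1| * 2 ^ |b - 1| := by
    refine rpow_le_two_rpow_mul_rpow _ ?_ ?_ one_le_two
    · rw [le_div_iff₀ hw0']
      linarith
    · rwa [div_le_iff₀ hw0']
  have hpow : (y / ‖w‖) ^ (b - 1) * y ^ (1 - b) = ‖w‖ ^ (1 - b) := by
    rw [Real.div_rpow hy0.le hw0'.le, div_mul_eq_mul_div, ← Real.rpow_add hy0,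
      div_eq_mul_inv, ← Real.rpow_neg hw0'.le]
    simp
  have hMy : M / y ≤ M / ‖w‖ := by gcongr
  set Q := (2 : ℝ) ^ |b - 1| * 2 ^ |b - 1| with hQ
  have hQ0 : 0 ≤ Q := by positivity
  calc ‖mittagLeffler 1 b w‖
      ≤ D / ‖w‖ + Real.exp w.re * (y / ‖w‖) ^ (b - 1) * ‖mittagLeffler 1 b (y * Complex.I)‖ := h2
    _ ≤ D / ‖w‖ + Real.exp w.re * (y / ‖w‖) ^ (b - 1) * (M * y ^ (1 - b) + M / y) := by gcongr
    _ = D / ‖w‖ + M * ‖w‖ ^ (1 - b) * Real.exp w.re +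
          Real.exp w.re * (y / ‖w‖) ^ (b - 1) * (M / y) := by
        rw [← hpow]
        ring
    _ ≤ D / ‖w‖ + M * ‖w‖ ^ (1 - b) * Real.exp w.re + 1 * Q * (M / ‖w‖) := by gcongr
    _ = M * ‖w‖ ^ (1 - b) * Real.exp w.re + (D + Q * M) / ‖w‖ := by ring
    _ ≤ _ := by
        have h4 : 0 ≤ Q * M := mul_nonneg hQ0 hM
        have h5 : M ≤ M + (D + Q * M) := by linarith
        have h6 : D + Q * M ≤ M + (D + Q * M) := by linarith
        exact add_le_add (by gcongr) (by gcongr)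

/-- Bound for the Mittag-Leffler function with first parameter `1` on the closed left half
plane. -/
theorem exists_norm_mittagLeffler_one_le (b : ℝ) :
    ∃ C : ℝ, 0 < C ∧ ∀ w : ℂ, w.re ≤ 0 →
      ‖mittagLeffler 1 b w‖ ≤
        C * (1 + ‖w‖) ^ (1 - b) * Real.exp w.re + C / (1 + ‖w‖) := by
  obtain ⟨C₀, hC₀, hsmall⟩ := exists_norm_mittagLeffler_le_of_norm_le_one one_pos b
  obtain ⟨C₁, hC₁, hlarge⟩ := exists_norm_mittagLeffler_one_le_of_one_le_norm b
  set Q := (2 : ℝ) ^ |1 - b| with hQ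
  refine ⟨C₀ + (2 * C₁ + C₁ * Q), by positivity, fun w hw => ?_⟩
  rcases le_total ‖w‖ 1 with hle | hge
  · refine (hsmall w hle).trans ?_
    have h1 : C₀ / (1 + ‖w‖) ≤ (C₀ + (2 * C₁ + C₁ * Q)) / (1 + ‖w‖) := by
      have : 0 ≤ 2 * C₁ + C₁ * Q := by positivity
      gcongr
      linarith
    have h2 : 0 ≤ (C₀ + (2 * C₁ + C₁ * Q)) * (1 + ‖w‖) ^ (1 - b) * Real.exp w.re := by positivity
    linarith
  · have hw0 : 0 < ‖w‖ := by linarith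
    have h1 : ‖mittagLeffler 1 b w‖ ≤ C₁ * ‖w‖ ^ (1 - b) * Real.exp w.re + C₁ / ‖w‖ := by
      rcases le_total 0 w.im with him | him
      · exact hlarge w hw him hge
      -- The lower quadrant follows by conjugation, since the series has real coefficients.
      · have := hlarge (starRingEnd ℂ w) (by simpa using hw) (by simpa using him)
          (by simpa using hge)
        rw [mittagLeffler_conj] at this
        simpa using this
    refine h1.trans (add_le_add ?_ ?_)
    · have hr : (‖w‖ / (1 + ‖w‖)) ^ (1 - b) ≤ Q := by
        have := rpow_le_two_rpow_mul_rpow (r := ‖w‖ / (1 + ‖w‖)) (T := 1) (1 - b)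
          (by rw [div_le_div_iff₀ (by norm_num) (by positivity)]; linarith)
          (by rw [div_le_one (by positivity)]; linarith) le_rfl
        rwa [Real.one_rpow, mul_one] at this
      rw [Real.div_rpow hw0.le (by positivity), div_le_iff₀ (by positivity)] at hr
      calc C₁ * ‖w‖ ^ (1 - b) * Real.exp w.re
          ≤ C₁ * (Q * (1 + ‖w‖) ^ (1 - b)) * Real.exp w.re := by gcongr
        _ = C₁ * Q * (1 + ‖w‖) ^ (1 - b) * Real.exp w.re := by ring
        _ ≤ _ := by
            gcongr
            linarith
    · rw [div_le_div_iff₀ hw0 (by positivity)]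
      have : 0 ≤ C₁ * Q * ‖w‖ := by positivity
      nlinarith

/-! ### Uniform bounds for all `1 / 2 < a ≤ 1`. -/

lemma exists_rpow_mul_exp_neg_le (p : ℝ) :
    ∃ C : ℝ, 0 < C ∧ ∀ x : ℝ, 0 ≤ x → (1 + x) ^ p * Real.exp (-x) ≤ C := by
  obtain ⟨n, hn⟩ := exists_nat_ge p
  refine ⟨n.factorial * Real.exp 1, by positivity, fun x hx => ?_⟩
  have h1 : (1 + x) ^ p ≤ (1 + x) ^ n := by
    rw [← Real.rpow_natCast]
    exact Real.rpow_le_rpow_of_exponent_le (by linarith) hn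
  have h2 := Real.pow_div_factorial_le_exp (1 + x) (by linarith) n
  rw [div_le_iff₀ (by positivity)] at h2
  calc (1 + x) ^ p * Real.exp (-x)
      ≤ Real.exp (1 + x) * n.factorial * Real.exp (-x) := by
        gcongr
        exact h1.trans h2
    _ = n.factorial * (Real.exp (1 + x) * Real.exp (-x)) := by ring
    _ = _ := by
        rw [← Real.exp_add]
        ring_nf

/-- Bounds for the Mittag-Leffler function on the closed left half plane and on the negative real
axis. -/
theorem exists_norm_mittagLeffler_le {a : ℝ} (ha : 1 / 2 < a) (ha1 : a ≤ 1) (b : ℝ) :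
    ∃ C : ℝ, 0 < C ∧ ∀ w : ℂ, w.re ≤ 0 →
      ‖mittagLeffler a b w‖ ≤ C * (1 + ‖w‖) ^ ((1 - b) / a) *
        Real.exp (w.re / ‖w‖ * ‖w‖ ^ (1 / a)) + C / (1 + ‖w‖) ∧
      (w.im = 0 → ‖mittagLeffler a b w‖ ≤ C / (1 + ‖w‖)) := by
  rcases ha1.lt_or_eq with hlt | rfl
  · obtain ⟨C, hC, h⟩ := exists_norm_mittagLeffler_le_of_lt_one ha hlt b
    refine ⟨C, hC, fun w hw => ⟨(h w hw).trans (le_add_of_nonneg_left (by positivity)),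
      fun _ => h w hw⟩⟩
  · obtain ⟨C, hC, h⟩ := exists_norm_mittagLeffler_one_le b
    -- On the negative axis `e ^ (Re w)` is `e ^ (-‖w‖)`; the exponent `2 - b = (1 - b) + 1` leaves
    -- room for the factor `1 / (1 + ‖w‖)`.
    obtain ⟨B, hB, hexp⟩ := exists_rpow_mul_exp_neg_le (2 - b)
    refine ⟨C + C * B, by positivity, fun w hw => ⟨?_, fun him => ?_⟩⟩
    · have e : w.re / ‖w‖ * ‖w‖ ^ (1 / (1 : ℝ)) = w.re := by
        rw [div_one, Real.rpow_one]
        rcases eq_or_ne w 0 with rfl | h0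
        · simp
        · exact div_mul_cancel₀ _ (norm_ne_zero_iff.2 h0)
      rw [e, div_one]
      have : C ≤ C + C * B := le_add_of_nonneg_right (by positivity)
      refine (h w hw).trans (add_le_add ?_ ?_) <;> gcongr
    · have e : w.re = -‖w‖ := by
        rw [← Complex.abs_re_eq_norm.2 him, abs_of_nonpos hw, neg_neg]
      have hp : 0 < 1 + ‖w‖ := by positivity
      have h1 := hexp ‖w‖ (norm_nonneg w)
      have h2 : (1 + ‖w‖) ^ (1 - b) = (1 + ‖w‖) ^ (2 - b) / (1 + ‖w‖) := by
        rw [← Real.rpow_sub_one hp.ne']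
        ring_nf
      refine (h w hw).trans ?_
      rw [e, h2, add_div, add_comm (C / _)]
      gcongr
      calc _ = C * ((1 + ‖w‖) ^ (2 - b) * Real.exp (-‖w‖)) / (1 + ‖w‖) := by ring
        _ ≤ _ := by gcongr

/-! ### Position of the points `z_ℓ^±` in the complex plane. -/

variable {c γ k : ℝ} {l : ℕ}

/-- `ϰ` is the nonnegative root of `x (x + 1) = ω ^ 2`. -/
lemma kappa_lt_iff : kappa c γ k < l ↔ omega c γ k ^ 2 < lam l := by
  have h : kappa c γ k < l ↔ Real.sqrt (1 + 4 * omega c γ k ^ 2) < 2 * l + 1 := by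
    unfold kappa
    constructor <;> intro h <;> linarith
  rw [h, Real.sqrt_lt' (by positivity), lam]
  constructor <;> intro h <;> nlinarith

lemma omega_pos (hc : 0 < c) (hγ : 0 < γ) (hk : 0 < k) : 0 < omega c γ k := by
  unfold omega
  positivity

lemma mul_omega_eq (hγ : 0 < γ) (hk : 0 < k) :
    k * c * omega c γ k = c ^ 2 / (2 * γ) := by
  unfold omega
  field_simp

lemma eq_mul_one_add_of_eq_zPlus_or_eq_zMinus {z : ℂ} (hz : z = zPlus c γ k l ∨ z = zMinus c γ k l) :
    ∃ e : ℝ, e ^ 2 = 1 ∧ z = ((c ^ 2 / (2 * γ) : ℝ) : ℂ) * (1 + e * bigM c γ k l) := by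
  rcases hz with rfl | rfl
  · exact ⟨1, by norm_num, by simp [zPlus]⟩
  · exact ⟨-1, by norm_num, by simp [zMinus, sub_eq_add_neg]⟩

/-- Here `M_ℓ` is purely imaginary, so `‖1 ± M_ℓ‖ ^ 2 = 1 + (λ_ℓ / ω ^ 2 - 1) = λ_ℓ / ω ^ 2`; the
prefactor is `k c ω`. -/
lemma re_eq_and_norm_eq_of_kappa_lt (hc : 0 < c) (hγ : 0 < γ) (hk : 0 < k)
    (hl : kappa c γ k < l) {z : ℂ} (hz : z = zPlus c γ k l ∨ z = zMinus c γ k l) :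
    z.re = k * c * omega c γ k ∧ ‖z‖ = k * c * Real.sqrt (lam l) := by
  obtain ⟨e, he, rfl⟩ := eq_mul_one_add_of_eq_zPlus_or_eq_zMinus hz
  have hω := omega_pos hc hγ hk
  have hlam := kappa_lt_iff.1 hl
  have hlam0 : 0 < lam l := lt_trans (by positivity) hlam
  have hm : 0 ≤ lam l / omega c γ k ^ 2 - 1 := by
    rw [sub_nonneg, one_le_div (by positivity)]
    exact hlam.le
  rw [← mul_omega_eq hγ hk, bigM, if_neg (not_le.2 hl)]
  have hre : (1 + (e : ℂ) * (Complex.I * (Real.sqrt (lam l / omega c γ k ^ 2 - 1) : ℝ))).re = 1 := by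
    simp
  have him : (1 + (e : ℂ) * (Complex.I * (Real.sqrt (lam l / omega c γ k ^ 2 - 1) : ℝ))).im =
      e * Real.sqrt (lam l / omega c γ k ^ 2 - 1) := by
    simp
  refine ⟨by rw [Complex.re_ofReal_mul, hre, mul_one], ?_⟩
  have hn : ‖(1 + (e : ℂ) * (Complex.I * (Real.sqrt (lam l / omega c γ k ^ 2 - 1) : ℝ)))‖ =
      Real.sqrt (lam l) / omega c γ k := by
    rw [Complex.norm_def, Complex.normSq_apply, hre, him]
    have : 1 * 1 + e * Real.sqrt (lam l / omega c γ k ^ 2 - 1) *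
        (e * Real.sqrt (lam l / omega c γ k ^ 2 - 1)) = lam l / omega c γ k ^ 2 := by
      have := Real.mul_self_sqrt hm
      linear_combination e ^ 2 * this + (lam l / omega c γ k ^ 2 - 1) * he
    rw [this, Real.sqrt_div hlam0.le, Real.sqrt_sq hω.le]
  rw [norm_mul, hn, Complex.norm_real, Real.norm_of_nonneg (by positivity)]
  field_simp

lemma re_nonneg_and_im_eq_zero_of_le_kappa (hγ : 0 < γ)
    (hl : l ≤ kappa c γ k) {z : ℂ} (hz : z = zPlus c γ k l ∨ z = zMinus c γ k l) :
    0 ≤ z.re ∧ z.im = 0 := by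
  obtain ⟨e, he, rfl⟩ := eq_mul_one_add_of_eq_zPlus_or_eq_zMinus hz
  rw [bigM, if_pos hl]
  set m := Real.sqrt (1 - lam l / omega c γ k ^ 2) with hm
  have hm1 : m ≤ 1 := by
    have : 0 ≤ lam l / omega c γ k ^ 2 := by
      unfold lam
      positivity
    exact Real.sqrt_le_one.2 (by linarith)
  have hm0 : 0 ≤ m := Real.sqrt_nonneg _
  have : ((c ^ 2 / (2 * γ) : ℝ) : ℂ) * (1 + e * (m : ℂ)) =
      ((c ^ 2 / (2 * γ) * (1 + e * m) : ℝ) : ℂ) := by push_cast; ring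
  rw [this, Complex.ofReal_re, Complex.ofReal_im]
  refine ⟨mul_nonneg (by positivity) ?_, rfl⟩
  rcases mul_self_eq_one_iff.1 ((sq e).symm.trans he) with rfl | rfl <;> linarith

end HyperbolicDiffusion

open HyperbolicDiffusion

theorem proposition2p3 (α : ℝ) (hα : 1 / 2 < α) (hα' : α ≤ 1) :
    ∃ K : ℝ → ℝ → ℝ → ℕ → ℝ,
      (∀ (c γ k : ℝ) (l : ℕ), 0 < c → 0 < γ → 0 < k →
        HyperbolicDiffusion.kappa c γ k < (l : ℝ) → 0 < K c γ k l) ∧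
      ∀ β : ℝ, ∃ C₁ C₂ C₃ : ℝ, 0 < C₁ ∧ 0 < C₂ ∧ 0 < C₃ ∧
        ∀ (c γ k : ℝ), 0 < c → 0 < γ → 0 < k →
        ∀ (l : ℕ) (t : ℝ), 0 ≤ t →
        ∀ z : ℂ, (z = HyperbolicDiffusion.zPlus c γ k l ∨ z = HyperbolicDiffusion.zMinus c γ k l) →
          (HyperbolicDiffusion.kappa c γ k < (l : ℝ) →
            ‖HyperbolicDiffusion.mittagLeffler α β (-z * ((t ^ α : ℝ) : ℂ))‖ ≤
              C₁ * (1 + k * c * t ^ α * Real.sqrt (HyperbolicDiffusion.lam l)) ^ ((1 - β) / α) *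
                  Real.exp (-(K c γ k l) * t *
                    (k ^ 2 * c ^ 2 * HyperbolicDiffusion.lam l) ^ (1 / (2 * α)))
                + C₂ / (1 + k * c * t ^ α * Real.sqrt (HyperbolicDiffusion.lam l))) ∧
          ((l : ℝ) ≤ HyperbolicDiffusion.kappa c γ k →
            ‖HyperbolicDiffusion.mittagLeffler α β (-z * ((t ^ α : ℝ) : ℂ))‖ ≤
              C₃ / (1 + ‖z‖ * t ^ α)) := by

  have hα0 : 0 < α := by linarith
  -- `K_ℓ` is `Re z / ‖z‖`, the same for both signs.
  refine ⟨fun c γ k l => omega c γ k / Real.sqrt (lam l), fun c γ k l hc hγ hk hl => ?_,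
    fun β => ?_⟩
  · have hω := omega_pos hc hγ hk
    have : 0 < lam l := lt_trans (by positivity) (kappa_lt_iff.1 hl)
    positivity
  obtain ⟨C, hC, hE⟩ := exists_norm_mittagLeffler_le hα hα' β
  refine ⟨C, C, C, hC, hC, hC, fun c γ k hc hγ hk l t ht z hz => ⟨fun hl => ?_, fun hl => ?_⟩⟩
  · obtain ⟨hre, hn⟩ := re_eq_and_norm_eq_of_kappa_lt hc hγ hk hl hz
    have hω := omega_pos hc hγ hk
    have hlam : 0 < lam l := lt_trans (by positivity) (kappa_lt_iff.1 hl)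
    set w := -z * ((t ^ α : ℝ) : ℂ) with hw
    have htα : 0 ≤ t ^ α := by positivity
    have hwre : w.re = -(k * c * omega c γ k) * t ^ α := by
      rw [hw, Complex.re_mul_ofReal, Complex.neg_re, hre]
    have hwn : ‖w‖ = k * c * t ^ α * Real.sqrt (lam l) := by
      rw [hw, norm_mul, norm_neg, hn, Complex.norm_real, Real.norm_of_nonneg htα]
      ring
    have hexp : w.re / ‖w‖ * ‖w‖ ^ (1 / α) =
        -(omega c γ k / Real.sqrt (lam l)) * t * (k ^ 2 * c ^ 2 * lam l) ^ (1 / (2 * α)) := by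
      -- At `t = 0` the quotient `w.re / ‖w‖` is `0 / 0 = 0` and both sides vanish. For `t > 0` the
      -- identity rests on `(t ^ α) ^ (1 / α) = t`.
      rcases ht.eq_or_lt with rfl | ht0
      · rw [hwn, Real.zero_rpow hα0.ne']
        simp [hα0.ne']
      · have htα0 : 0 < t ^ α := by positivity
        have h1 : k ^ 2 * c ^ 2 * lam l = (k * c * Real.sqrt (lam l)) ^ (2 : ℝ) := by
          rw [Real.rpow_two, mul_pow, Real.sq_sqrt hlam.le]
          ring
        have h2 : 2 * (1 / (2 * α)) = 1 / α := by field_simp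
        have h3 : k * c * t ^ α * Real.sqrt (lam l) = k * c * Real.sqrt (lam l) * t ^ α := by ring
        rw [h1, ← Real.rpow_mul (by positivity), h2, hwn, hwre, h3,
          Real.mul_rpow (by positivity) htα, ← Real.rpow_mul ht, mul_one_div_cancel hα0.ne',
          Real.rpow_one]
        field_simp
    have hw0 : w.re ≤ 0 := by
      rw [hwre]
      exact mul_nonpos_of_nonpos_of_nonneg (neg_nonpos.2 (by positivity)) htα
    have h := (hE w hw0).1
    rwa [hexp, hwn] at h
  · obtain ⟨hre, him⟩ := re_nonneg_and_im_eq_zero_of_le_kappa hγ hl hz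
    have htα : 0 ≤ t ^ α := by positivity
    have h := (hE (-z * ((t ^ α : ℝ) : ℂ)) (by
      rw [Complex.re_mul_ofReal, Complex.neg_re]
      exact mul_nonpos_of_nonpos_of_nonneg (neg_nonpos.2 hre) htα)).2
      (by rw [Complex.im_mul_ofReal, Complex.neg_im, him]; simp)
    rwa [norm_mul, norm_neg, Complex.norm_real, Real.norm_of_nonneg htα] at h
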